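/- Let $\Bbbk$ be a field, let $m_1,m_2,m_3\ge 2$ be integers, and let $A=\Bbbk[w,x,y]/(w^{m_1},x^{m_2},y^{m_3})$, augmented by $\varepsilon:A\to\Bbbk$, $w,x,y\mapsto 0$. **The Anick resolution.** Order the words in the letters $w<x<y$ by degree, then lexicographically. A word is *normal* if its image in $A$ is not a linear combination of images of smaller words; the normal words form a basis of $A$. A *tip* is a non-normal word all of whose proper subwords are normal. Consider the quiver whose vertices are $1$ and the proper prefixes of tips, with arrows $1\to w$, $1\to x$, $1\to y$ and an arrow $f\to g$ whenever the word $gf$ contains exactly one occurrence of a tip and this occurrence is a prefix of $gf$. Let $C_n$ be the set of paths of length $n$ starting at $1$, where the path $1\to f_1\to\cdots\to f_n$ is written as $f_n\cdots f_1$, and let $C_0=\{1\}$. The Anick resolution $P_\bullet$ of $\Bbbk$ has $P_n=A\otimes_{\Bbbk}\Bbbk C_n$, with $P_0=A$ augmented by $\varepsilon$. Its $A$-linear differentials $d_n:P_n\to P_{n-1}$ are defined recursively together with maps $s_{n-1}:P_{n-1}\to P_n$: * $d_1(1\otimes v)=v$ for $v\in\{w,x,y\}$, and $s_0$ is $\Bbbk$-linear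 with $s_0(1)=0$ and $s_0(uv)=u\otimes v$ for each normal word $uv$ that ends in the letter $v$; * for $n\ge 2$ and $u=ru'\in C_n$ with last vertex $r$ and $u'\in C_{n-1}$, $d_n(1\otimes u)=r\otimes u'-s_{n-2}d_{n-1}(r\otimes u')$; * for $n\ge2$, $s_{n-1}$ vanishes on $\operatorname{im}s_{n-2}$, and on $\ker d_{n-1}$ it is given by $s_{n-1}(0)=0$ and $s_{n-1}(z)=c\,v'\otimes tu_1+s_{n-1}\bigl(z-d_n(c\,v'\otimes tu_1)\bigr)$, where $c\,r_1\otimes u_1$ ($c\in\Bbbk$, $r_1$ a normal word, $u_1\in C_{n-1}$) is the term of $z$ with the greatest word $r_1u_1$, and $r_1=v't$ is the factorization for which $tu_1\in C_n$. **Notation.** For $a\in\{1,2,3\}$ let $\sigma_a(\ell)=1$ if $\ell$ is odd and $\sigma_a(\ell)=m_a-1$ if $\ell$ is even. For $i,j,k\ge0$ let $u_{ijk}$ be the path $1\to w^{\sigma_1(1)}\to\cdots\to w^{\sigma_1(i)}\to x^{\sigma_2(1)}\to\cdots\to x^{\sigma_2(j)}\to y^{\sigma_3(1)}\to\cdots\to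 y^{\sigma_3(k)}$, and set $u_{ijk}=0$ if one of the indices is negative. **Statement.** 1. For each $n\ge 0$, $C_n$ consists of the paths $u_{ijk}$ with $i,j,k\ge0$ and $i+j+k=n$, and these are pairwise distinct. $P_\bullet$ is an augmented complex of free $A$-modules, and for all $i,j,k\ge 0$ with $n=i+j+k\ge1$, $$d_n(1\otimes u_{ijk})=y^{\sigma_3(k)}\otimes u_{i,j,k-1}+(-1)^k x^{\sigma_2(j)}\otimes u_{i,j-1,k}+(-1)^{j+k}w^{\sigma_1(i)}\otimes u_{i-1,j,k}.$$ 2. Let $A_w=\Bbbk[w]/(w^{m_1})$, $A_x=\Bbbk[x]/(x^{m_2})$, $A_y=\Bbbk[y]/(y^{m_3})$, and let $P(A_w)$ be the sequence $$\cdots\xrightarrow{w^{m_1-1}}A_w\xrightarrow{\ w\ }A_w\xrightarrow{w^{m_1-1}}A_w\xrightarrow{\ w\ }A_w\xrightarrow{\ \varepsilon\ }\Bbbk\to0,$$ with $P(A_x)$ and $P(A_y)$ defined in the same way. These are minimal free resolutions of $\Bbbk$ over $A_w$, $A_x$, $A_y$. Let $K_\bullet=\operatorname{Tot}\bigl(P(A_y)\otimes_{\Bbbk}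 P(A_x)\otimes_{\Bbbk} P(A_w)\bigr)$, an augmented complex of modules over $A_y\otimes_{\Bbbk} A_x\otimes_{\Bbbk} A_w\cong A$. Then for each $n$ there is an isomorphism of $A$-modules $\psi_n:P_n\to K_n$ such that $\psi_\bullet$ is a chain map lifting the identity map of $\Bbbk$. -/

import Mathlib

open scoped TensorProduct

noncomputable section

/-! ### Augmented algebras with an ordered generating family -/

/-- An augmented `𝕜`-algebra `A` presented as a quotient of the free algebra on the letters `ι`:
the letters map to generators of `A` on which the augmentation vanishes. The ideal of relations
is the kernel of the resulting surjection from the free algebra to `A`. -/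
structure AugPresentation (𝕜 ι A : Type*) [Field 𝕜] [Ring A] [Algebra 𝕜 A] where
  /-- the generators -/
  gen : ι → A
  /-- the augmentation -/
  aug : A →ₐ[𝕜] 𝕜
  adjoin_gen : Algebra.adjoin 𝕜 (Set.range gen) = ⊤
  aug_gen : ∀ i, aug (gen i) = 0

namespace AugPresentation

variable {𝕜 ι A : Type*} [Field 𝕜] [LinearOrder ι] [Ring A] [Algebra 𝕜 A]
variable (S : AugPresentation 𝕜 ι A)

/-- The image in `A` of a word in the letters. -/
def eval (w : List ι) : A := (w.map S.gen).prod

/-- The degree lexicographic order on words. -/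
def WordLT (v w : List ι) : Prop := List.Shortlex (· < ·) v w

/-- A word is normal if its image in `A` is not a linear combination of smaller words. -/
def IsNormal (w : List ι) : Prop :=
  S.eval w ∉ Submodule.span 𝕜 (S.eval '' {v | WordLT v w})

/-- A tip is a word that is not normal but all of whose proper (contiguous) subwords are normal. -/
def IsTip (w : List ι) : Prop :=
  ¬ S.IsNormal w ∧ ∀ v, v <:+: w → v ≠ w → S.IsNormal v

/-- The proper prefixes of tips. -/
def IsTipPrefix (r : List ι) : Prop := ∃ t, S.IsTip t ∧ r <+: t ∧ r ≠ t

/-- There is an arrow `f → g` (with `f ≠ 1`) in the quiver if `g` is a proper prefix of a tip and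
the word `gf` contains exactly one occurrence of a tip, and this occurrence is a prefix. -/
def Arrow (f g : List ι) : Prop :=
  S.IsTipPrefix g ∧ ∃ t, S.IsTip t ∧ t <+: g ++ f ∧
    ∀ p t' q, S.IsTip t' → g ++ f = p ++ t' ++ q → p = [] ∧ t' = t

/-- Paths in the quiver that start at `1`, as the list of the vertices after `1`, written from
right to left: `[h, g, f]` is the path `1 → f → g → h`. The arrows out of `1` go to the letters. -/
def IsPath : List (List ι) → Prop
  | [] => True
  | [f] => ∃ i, f = [i]
  | g :: f :: p => S.Arrow f g ∧ IsPath (f :: p)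

/-- Membership in `C_n`: the path has length `n` and starts at `1`. -/
def IsChain (n : ℕ) (p : List (List ι)) : Prop := p.length = n ∧ S.IsPath p

/-- The set `C_n`. -/
def Chain (n : ℕ) : Type _ := {p : List (List ι) // S.IsChain n p}

variable {S}

/-- The last vertex `r` of a path `u = r u'`. -/
def Chain.top {n : ℕ} (u : S.Chain (n + 1)) : List ι :=
  u.1.head (List.ne_nil_of_length_eq_add_one u.2.1)

/-- The path `u'` obtained from a path `u = r u'` by removing the last vertex. -/
def Chain.tail {n : ℕ} (u : S.Chain (n + 1)) : S.Chain n :=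
  ⟨u.1.tail, by
    obtain ⟨p, hl, hp⟩ := u
    refine ⟨by simp [hl], ?_⟩
    match p, hp with
    | [], _ => trivial
    | [f], _ => trivial
    | g :: f :: p, hp => exact hp.2⟩

/-- The word of a path: the product of its vertices. -/
def Chain.word {n : ℕ} (u : S.Chain n) : List ι := u.1.flatten

variable (S)

/-- The unique element of `C_0`. -/
def nilChain : S.Chain 0 := ⟨[], rfl, trivial⟩

/-- The element of `C_1` given by a letter. -/
def letterChain (i : ι) : S.Chain 1 := ⟨[[i]], rfl, i, rfl⟩

/-- The normal words. -/
def NormalWord : Type _ := {w : List ι // S.IsNormal w}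

theorem linearIndependent_normal :
    LinearIndependent 𝕜 (fun w : S.NormalWord => S.eval w.1) := by
  classical
  rw [linearIndependent_iff]
  intro l hl
  by_contra hne
  have hmax : ∀ s : Finset S.NormalWord, s.Nonempty →
      ∃ w ∈ s, ∀ v ∈ s, v ≠ w → WordLT v.1 w.1 := by
    intro s hs
    induction hs using Finset.Nonempty.cons_induction with
    | singleton a => exact ⟨a, by simp, by simp⟩
    | cons a s ha hs ih =>
      obtain ⟨w, hw, hmw⟩ := ih
      have trans : ∀ {a b c : List ι}, WordLT a b → WordLT b c → WordLT a c := by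
        intro a b c hab hbc
        unfold WordLT at *
        rw [List.shortlex_def] at *
        rcases hab with hab | hab <;> rcases hbc with hbc | hbc
        · left; omega
        · left; omega
        · left; omega
        · right; exact ⟨by omega, List.lt_trans (α := ι) hab.2 hbc.2⟩
      by_cases haw : WordLT a.1 w.1
      · refine ⟨w, by simp [hw], ?_⟩
        intro v hv hvw
        rcases Finset.mem_cons.1 hv with rfl | hv
        · exact haw
        · exact hmw v hv hvw
      · have hwa : WordLT w.1 a.1 := by
          by_contra h
          have := (List.Shortlex.trichotomous (r := ((· < ·) : ι → ι → Prop))).trichotomous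
            a.1 w.1 haw h
          exact ha (Subtype.ext this ▸ hw)
        refine ⟨a, by simp, ?_⟩
        intro v hv hva
        rcases Finset.mem_cons.1 hv with rfl | hv
        · exact absurd rfl hva
        · by_cases h : v = w
          · exact h ▸ hwa
          · exact trans (hmw v hv h) hwa
  obtain ⟨w, hw, hm⟩ := hmax l.support (Finsupp.support_nonempty_iff.2 hne)
  apply w.2
  rw [Finsupp.linearCombination_apply, Finsupp.sum, ← Finset.add_sum_erase _ _ hw] at hl
  have h1 : S.eval w.1 = -((l w)⁻¹ • ∑ v ∈ l.support.erase w, l v • S.eval v.1) := by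
    have h2 := eq_neg_of_add_eq_zero_left hl
    rw [← smul_neg, ← h2, inv_smul_smul₀ (Finsupp.mem_support_iff.1 hw)]
  rw [h1]
  refine Submodule.neg_mem _ (Submodule.smul_mem _ _ (Submodule.sum_mem _ fun v hv => ?_))
  rw [Finset.mem_erase] at hv
  exact Submodule.smul_mem _ _ (Submodule.subset_span ⟨v.1, hm v hv.2 hv.1, rfl⟩)

variable [Finite ι]

theorem span_normal :
    ⊤ ≤ Submodule.span 𝕜 (Set.range fun w : S.NormalWord => S.eval w.1) := by
  have hw : ∀ w : List ι,
      S.eval w ∈ Submodule.span 𝕜 (Set.range fun w : S.NormalWord => S.eval w.1) := by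
    intro w
    induction w using (List.Shortlex.wf (r := ((· < ·) : ι → ι → Prop)) wellFounded_lt).induction with
    | _ w ih =>
      by_cases hn : S.IsNormal w
      · exact Submodule.subset_span ⟨⟨w, hn⟩, rfl⟩
      · have := not_not.1 hn
        refine Submodule.span_le.2 ?_ this
        rintro _ ⟨v, hv, rfl⟩
        exact ih v hv
  have h := Algebra.adjoin_eq_span 𝕜 (Set.range S.gen)
  rw [S.adjoin_gen, Algebra.top_toSubmodule] at h
  rw [h, Submodule.span_le]
  intro a ha
  have : ∃ w : List ι, S.eval w = a := by
    induction ha using Submonoid.closure_induction with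
    | mem x hx =>
      obtain ⟨i, rfl⟩ := hx
      exact ⟨[i], by simp [eval]⟩
    | one => exact ⟨[], by simp [eval]⟩
    | mul x y _ _ hx hy =>
      obtain ⟨v, rfl⟩ := hx
      obtain ⟨w, rfl⟩ := hy
      exact ⟨v ++ w, by simp [eval]⟩
  obtain ⟨w, rfl⟩ := this
  exact hw w

/-- The basis of `A` given by the normal words. -/
def normalBasis : Module.Basis S.NormalWord 𝕜 A :=
  Module.Basis.mk S.linearIndependent_normal S.span_normal

/-! ### The Anick resolution -/

/-- The free left `A`-module `A ⊗ 𝕜 C_n`, that is, `P_n`. -/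
abbrev Free (n : ℕ) : Type _ := S.Chain n →₀ A

/-- The element `r ⊗ u` of `A ⊗ 𝕜 C_n`, for a word `r` and `u ∈ C_n`. -/
def ten {n : ℕ} (r : List ι) (u : S.Chain n) : S.Free n := Finsupp.single u (S.eval r)

/-- The coefficient of `x ∈ A ⊗ 𝕜 C_n` at the basis element `r ⊗ u`, with `r` a normal word. -/
def coeff {n : ℕ} (x : S.Free n) (r : S.NormalWord) (u : S.Chain n) : 𝕜 :=
  S.normalBasis.repr (x u) r

/-- `r ⊗ u` is the highest term of `x`, for the order of the words `ru`. -/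
def IsHighest {n : ℕ} (x : S.Free n) (r : S.NormalWord) (u : S.Chain n) : Prop :=
  S.coeff x r u ≠ 0 ∧ ∀ (r' : S.NormalWord) (u' : S.Chain n), S.coeff x r' u' ≠ 0 →
    (r', u') ≠ (r, u) → WordLT (r'.1 ++ u'.word) (r.1 ++ u.word)

/-- The recursive rule that computes the contracting homotopy on the kernel of a differential,
from the next differential `d`. The value at `0` is `0`. If the highest term of `x` is `c r₁ ⊗ u₁`,
with `r₁ = v t` for a vertex `t` such that `u = t u₁` is a path, then the value at `x` is
`c v ⊗ t u₁` plus the value at `x - d (c v ⊗ t u₁)`. -/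
inductive Reduces {n : ℕ} (d : S.Free (n + 2) →ₗ[A] S.Free (n + 1)) :
    S.Free (n + 1) → S.Free (n + 2) → Prop
  | zero : Reduces d 0 0
  | step (x : S.Free (n + 1)) (y : S.Free (n + 2)) (r : S.NormalWord) (v : List ι)
      (u : S.Chain (n + 2)) (hr : r.1 = v ++ u.top) (hx : S.IsHighest x r u.tail)
      (hy : Reduces d (x - d (S.coeff x r u.tail • S.ten v u)) y) :
      Reduces d x (S.coeff x r u.tail • S.ten v u + y)

open Classical in
/-- The value computed by the recursive rule (`0` where the rule computes none). -/
def reduce {n : ℕ} (d : S.Free (n + 2) →ₗ[A] S.Free (n + 1)) (x : S.Free (n + 1)) :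
    S.Free (n + 2) :=
  if h : ∃ y, S.Reduces d x y then h.choose else 0

/-- The value of `s_0` at a normal word: `s_0 1 = 0` and `s_0 (u vᵢ) = u ⊗ vᵢ`. -/
def sZeroWord (w : List ι) : S.Free 1 :=
  if h : w = [] then 0 else S.ten w.dropLast (S.letterChain (w.getLast h))

/-- The `𝕜`-linear map `s_0 : A → A ⊗ 𝕜 C_1`. -/
def sZero : A →ₗ[𝕜] S.Free 1 := S.normalBasis.constr 𝕜 fun w => S.sZeroWord w.1

/-- A differential `d_{n+1} : P_{n+1} → P_n` and a map `s_n : P_n → P_{n+1}`. -/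
structure Stage (n : ℕ) where
  /-- the differential -/
  d : S.Free (n + 1) →ₗ[A] S.Free n
  /-- the contracting homotopy -/
  s : S.Free n → S.Free (n + 1)

/-- The simultaneous recursive construction of the differentials and of the contracting homotopy.
In degree one, `d_1 (1 ⊗ vᵢ) = vᵢ` (where `A` is identified with `A ⊗ 𝕜 C_0`) and `s_0` is as above.
Then `d_n (1 ⊗ r u') = r ⊗ u' - s_{n-2} (d_{n-1} (r ⊗ u'))`, and `s_{n-1}` is given by the recursive
rule on `ker d_{n-1}` and by `0` on the image of `s_{n-2}`, where
`b = (b - s_{n-2} (d_{n-1} b)) + s_{n-2} (d_{n-1} b)` is the decomposition of `b` along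
`A ⊗ 𝕜 C_{n-1} = ker d_{n-1} ⊕ im s_{n-2}`. -/
def stage : (n : ℕ) → S.Stage n
  | 0 =>
    { d := Finsupp.linearCombination A fun u : S.Chain 1 => S.ten u.top S.nilChain
      s := fun x => S.sZero (x S.nilChain) }
  | n + 1 =>
    let d' : S.Free (n + 2) →ₗ[A] S.Free (n + 1) :=
      Finsupp.linearCombination A fun u : S.Chain (n + 2) =>
        S.ten u.top u.tail - (stage n).s ((stage n).d (S.ten u.top u.tail))
    { d := d'
      s := fun b => S.reduce d' (b - (stage n).s ((stage n).d b)) }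

/-- The differential `d_{n+1} : P_{n+1} → P_n` of the Anick resolution. -/
def anickD (n : ℕ) : S.Free (n + 1) →ₗ[A] S.Free n := (S.stage n).d

/-- The augmentation `P_0 = A → 𝕜` of the Anick resolution. -/
def anickAug (x : S.Free 0) : 𝕜 := S.aug (x S.nilChain)

end AugPresentation

/-! ### Truncated polynomial rings -/

/-- The exponents `σ(ℓ)` for the truncation degree `m`. -/
def truncSigma (m ℓ : ℕ) : ℕ := if Odd ℓ then 1 else m - 1

/-- The algebra `𝕜[w,x,y]/(w^{m₁}, x^{m₂}, y^{m₃})`; the variables `w, x, y` have the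
indices `0, 1, 2`, ordered as `w < x < y`. -/
abbrev TruncPoly₃ (𝕜 : Type*) [Field 𝕜] (m : Fin 3 → ℕ) : Type _ :=
  MvPolynomial (Fin 3) 𝕜 ⧸
    Ideal.span (Set.range fun a : Fin 3 => (MvPolynomial.X a ^ m a : MvPolynomial (Fin 3) 𝕜))

/-- The class of a variable in `𝕜[w,x,y]/(w^{m₁}, x^{m₂}, y^{m₃})`. -/
def truncVar₃ (𝕜 : Type*) [Field 𝕜] (m : Fin 3 → ℕ) (a : Fin 3) : TruncPoly₃ 𝕜 m :=
  Ideal.Quotient.mk _ (MvPolynomial.X a)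

/-- The algebra `𝕜[w,x,y]/(w^{m₁}, x^{m₂}, y^{m₃})` with its generators `w < x < y` and the
augmentation that vanishes on them. -/
def truncPresentation (𝕜 : Type*) [Field 𝕜] (m : Fin 3 → ℕ) (hm : ∀ a, 2 ≤ m a) :
    AugPresentation 𝕜 (Fin 3) (TruncPoly₃ 𝕜 m) where
  gen := truncVar₃ 𝕜 m
  aug := Ideal.Quotient.liftₐ _ (MvPolynomial.aeval fun _ => (0 : 𝕜)) (by
    intro p hp
    rw [← RingHom.mem_ker]
    refine Ideal.span_le.2 ?_ hp
    rintro _ ⟨a, rfl⟩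
    have : m a ≠ 0 := by have := hm a; omega
    simp [RingHom.mem_ker, this])
  adjoin_gen := by
    have h : Set.range (truncVar₃ 𝕜 m) =
        (Ideal.Quotient.mkₐ 𝕜 (Ideal.span (Set.range fun a : Fin 3 =>
          (MvPolynomial.X a ^ m a : MvPolynomial (Fin 3) 𝕜)))) '' Set.range MvPolynomial.X := by
      rw [← Set.range_comp]; rfl
    rw [h, ← AlgHom.map_adjoin, MvPolynomial.adjoin_range_X, Algebra.map_top, AlgHom.range_eq_top]
    exact Ideal.Quotient.mkₐ_surjective _ _
  aug_gen := by
    intro i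
    change (Ideal.Quotient.lift _ _ _) (Ideal.Quotient.mk _ _) = _
    simp

/-- The path `1 → a → a^{m-1} → a → ⋯` with `ℓ` vertices after `1`, all of them powers of the
letter `a`, written from right to left; the `ℓ`-th vertex is `a^{σ(ℓ)}`. -/
def powPath (a : Fin 3) (m : ℕ) : ℕ → List (List (Fin 3))
  | 0 => []
  | ℓ + 1 => List.replicate (truncSigma m (ℓ + 1)) a :: powPath a m ℓ

/-- The path `u_{ijk}`: first `i` powers of `w`, then `j` powers of `x`, then `k` powers of `y`. -/
def triPath (m : Fin 3 → ℕ) (i j k : ℕ) : List (List (Fin 3)) :=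
  powPath 2 (m 2) k ++ powPath 1 (m 1) j ++ powPath 0 (m 0) i

open Classical in
/-- The element `1 ⊗ u_{ijk}` of `P_n`, with `u_{ijk} = 0` if an index is negative. -/
def uElt (𝕜 : Type*) [Field 𝕜] (m : Fin 3 → ℕ) (hm : ∀ a, 2 ≤ m a) (n : ℕ) (i j k : ℤ) :
    (truncPresentation 𝕜 m hm).Free n :=
  if h : (0 ≤ i ∧ 0 ≤ j ∧ 0 ≤ k) ∧
      (truncPresentation 𝕜 m hm).IsChain n (triPath m i.toNat j.toNat k.toNat) then
    Finsupp.single ⟨triPath m i.toNat j.toNat k.toNat, h.2⟩ 1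
  else 0

/-! ### The periodic resolutions and their tensor product -/

/-- The truncated polynomial ring `𝕜[x]/(x^m)` in one variable. -/
abbrev TruncPoly₁ (𝕜 : Type*) [Field 𝕜] (m : ℕ) : Type _ :=
  AdjoinRoot (Polynomial.X ^ m : Polynomial 𝕜)

/-- The class of the variable in `𝕜[x]/(x^m)`. -/
def truncVar₁ (𝕜 : Type*) [Field 𝕜] (m : ℕ) : TruncPoly₁ 𝕜 m :=
  AdjoinRoot.root (Polynomial.X ^ m : Polynomial 𝕜)

/-- The augmentation of `𝕜[x]/(x^m)`, with `x ↦ 0`. -/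
def truncAug₁ (𝕜 : Type*) [Field 𝕜] (m : ℕ) (hm : 2 ≤ m) : TruncPoly₁ 𝕜 m →ₐ[𝕜] 𝕜 :=
  AdjoinRoot.liftAlgHom (Polynomial.X ^ m : Polynomial 𝕜) (Algebra.ofId 𝕜 𝕜) 0 (by
    have : m ≠ 0 := by omega
    simp [this])

/-- The differential from degree `n + 1` to degree `n` of the periodic resolution of `𝕜` over
`B = 𝕜[x]/(x^m)`, which is `B` in each degree: multiplication by `x` if `n + 1` is odd and
by `x^{m-1}` if `n + 1` is even. -/
def periodicD (𝕜 : Type*) [Field 𝕜] (m n : ℕ) :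
    TruncPoly₁ 𝕜 m →ₗ[TruncPoly₁ 𝕜 m] TruncPoly₁ 𝕜 m :=
  LinearMap.mulLeft (TruncPoly₁ 𝕜 m) (truncVar₁ 𝕜 m ^ truncSigma m (n + 1))

/-- For a local `𝕜`-algebra `B` augmented by `ε`, whose maximal ideal is `ker ε`: the sequence
`⋯ → B → B → B → 𝕜 → 0` with differentials `d n` is exact, hence a free resolution of `𝕜`, and it
is minimal, that is, each differential maps into `ker ε`. -/
def IsMinimalResolution {𝕜 B : Type*} [Field 𝕜] [CommRing B] [Algebra 𝕜 B]
    (d : ℕ → B →ₗ[B] B) (ε : B →ₐ[𝕜] 𝕜) : Prop :=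
  Function.Surjective ε ∧ Function.Exact (d 0) ε ∧ (∀ n, Function.Exact (d (n + 1)) (d n)) ∧
    ∀ n b, ε (d n b) = 0

/-- The triples `(i, j, k)` with `i + j + k = n`. -/
abbrev TriDeg (n : ℕ) : Type := {t : ℕ × ℕ × ℕ // t.1 + t.2.1 + t.2.2 = n}

section Tot

variable {𝕜 Y X W : Type*} [Field 𝕜]
  [AddCommGroup Y] [Module 𝕜 Y] [AddCommGroup X] [Module 𝕜 X] [AddCommGroup W] [Module 𝕜 W]

/-- The differential from degree `n + 1` to degree `n` of the total complex of the tensor product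
`Y ⊗ X ⊗ W` of three complexes that are constant as graded modules. In degree `n`, the total complex
is the direct sum over the finitely many triples `(i, j, k)` with `i + j + k = n` of
`Y_k ⊗ X_j ⊗ W_i`, and the differential is
`d (a ⊗ b ⊗ c) = da ⊗ b ⊗ c + (-1)^k a ⊗ db ⊗ c + (-1)^{k + j} a ⊗ b ⊗ dc`. -/
def totD (dY : ℕ → Y →ₗ[𝕜] Y) (dX : ℕ → X →ₗ[𝕜] X) (dW : ℕ → W →ₗ[𝕜] W) (n : ℕ) :
    (TriDeg (n + 1) → (Y ⊗[𝕜] X) ⊗[𝕜] W) →ₗ[𝕜] (TriDeg n → (Y ⊗[𝕜] X) ⊗[𝕜] W) :=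
  LinearMap.pi fun t : TriDeg n =>
    let i := t.1.1
    let j := t.1.2.1
    let k := t.1.2.2
    have h : i + j + k = n := t.2
    (TensorProduct.map (TensorProduct.map (dY k) LinearMap.id) LinearMap.id) ∘ₗ
        LinearMap.proj (⟨(i, j, k + 1), by change i + j + (k + 1) = n + 1; omega⟩ : TriDeg (n + 1)) +
      (-1 : 𝕜) ^ k •
        (TensorProduct.map (TensorProduct.map LinearMap.id (dX j)) LinearMap.id) ∘ₗ
          LinearMap.proj
            (⟨(i, j + 1, k), by change i + (j + 1) + k = n + 1; omega⟩ : TriDeg (n + 1)) +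
      (-1 : 𝕜) ^ (k + j) •
        (TensorProduct.map (TensorProduct.map LinearMap.id LinearMap.id) (dW i)) ∘ₗ
          LinearMap.proj
            (⟨(i + 1, j, k), by change i + 1 + j + k = n + 1; omega⟩ : TriDeg (n + 1))

/-- The augmentation `ε ⊗ ε ⊗ ε` of the total complex, in degree `0`. -/
def totAug (εY : Y →ₗ[𝕜] 𝕜) (εX : X →ₗ[𝕜] 𝕜) (εW : W →ₗ[𝕜] 𝕜) :
    (TriDeg 0 → (Y ⊗[𝕜] X) ⊗[𝕜] W) →ₗ[𝕜] 𝕜 :=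
  LinearMap.mul' 𝕜 𝕜 ∘ₗ
    TensorProduct.map (LinearMap.mul' 𝕜 𝕜 ∘ₗ TensorProduct.map εY εX) εW ∘ₗ
      LinearMap.proj (⟨(0, 0, 0), rfl⟩ : TriDeg 0)

end Tot

/-- The algebra `A_y ⊗ A_x ⊗ A_w`. -/
abbrev TruncTensor (𝕜 : Type*) [Field 𝕜] (m : Fin 3 → ℕ) : Type _ :=
  (TruncPoly₁ 𝕜 (m 2) ⊗[𝕜] TruncPoly₁ 𝕜 (m 1)) ⊗[𝕜] TruncPoly₁ 𝕜 (m 0)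

/-- The component in degree `n` of `K = Tot (P(A_y) ⊗ P(A_x) ⊗ P(A_w))`. -/
abbrev KMod (𝕜 : Type*) [Field 𝕜] (m : Fin 3 → ℕ) (n : ℕ) : Type _ :=
  TriDeg n → TruncTensor 𝕜 m

/-- The differential from degree `n + 1` to degree `n` of `K`. -/
def KD (𝕜 : Type*) [Field 𝕜] (m : Fin 3 → ℕ) (n : ℕ) : KMod 𝕜 m (n + 1) →ₗ[𝕜] KMod 𝕜 m n :=
  totD (fun l => (periodicD 𝕜 (m 2) l).restrictScalars 𝕜)
    (fun l => (periodicD 𝕜 (m 1) l).restrictScalars 𝕜)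
    (fun l => (periodicD 𝕜 (m 0) l).restrictScalars 𝕜) n

/-- The augmentation of `K`. -/
def KAug (𝕜 : Type*) [Field 𝕜] (m : Fin 3 → ℕ) (hm : ∀ a, 2 ≤ m a) : KMod 𝕜 m 0 →ₗ[𝕜] 𝕜 :=
  totAug (truncAug₁ 𝕜 (m 2) (hm 2)).toLinearMap (truncAug₁ 𝕜 (m 1) (hm 1)).toLinearMap
    (truncAug₁ 𝕜 (m 0) (hm 0)).toLinearMap

end

/-
A word is normal if and only if it is sorted and each letter `a` occurs less than `m a` times in it,
so the tips are the words `ca` with `a < c` and the powers `a ^ m a`. After the vertex `a ^ σ(l)` a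
path can therefore only continue with `a ^ σ(l + 1)` or with a greater letter, and the chains are
the `u_{ijk}`.

The claimed differential squares to zero, since the exponents `σ(l)` and `σ(l + 1)` add up to the
truncation degree. Its first nonzero term at `u = r u'` is `r ⊗ u'`, so `r ⊗ u'` has the same
boundary as the negative of the remaining terms. The highest term of this boundary comes from the
first remaining term, which the recursive rule recovers from it; what is then left is the boundary
of the other remaining terms. Hence `s (d (r ⊗ u'))` is the negative of the remaining terms, and
subtracting it from `r ⊗ u'` gives the claimed differential.
-/

section Lists

variable {α : Type*} [LinearOrder α]

theorem not_lt_of_perm_of_pairwise_le {v w : List α} (h : v.Perm w)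
    (hw : w.Pairwise (· ≤ ·)) : ¬ v < w := by
  induction w generalizing v with
  | nil => simp
  | cons a w ih =>
    cases v with
    | nil => simp at h
    | cons b v =>
      rw [List.pairwise_cons] at hw
      rw [List.cons_lt_cons_iff]
      rintro (hba | ⟨rfl, hvw⟩)
      · rcases List.mem_cons.1 (h.subset List.mem_cons_self) with rfl | hb
        · exact lt_irrefl _ hba
        · exact (hw.1 b hb).not_gt hba
      · exact ih h.cons_inv hw.2 hvw

theorem exists_infix_pair_of_not_pairwise_le {w : List α} (h : ¬ w.Pairwise (· ≤ ·)) :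
    ∃ a c, a < c ∧ [c, a] <:+: w := by
  rw [← List.isChain_iff_pairwise, List.isChain_iff_forall_rel_of_append_cons_cons] at h
  push Not at h
  obtain ⟨c, a, l₁, l₂, rfl, hac⟩ := h
  exact ⟨a, c, hac, l₁, l₂, by simp⟩

theorem replicate_count_prefix_of_pairwise_le {a : α} {w : List α} (hw : w.Pairwise (· ≤ ·))
    (ha : ∀ b ∈ w, a ≤ b) : List.replicate (w.count a) a <+: w := by
  induction w with
  | nil => simp
  | cons b w ih =>
    rw [List.pairwise_cons] at hw
    by_cases hb : b = a
    · subst hb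
      rw [List.count_cons_self, List.replicate_succ, List.cons_prefix_cons]
      exact ⟨rfl, ih hw.2 hw.1⟩
    · have hcount : (b :: w).count a = 0 := by
        rw [List.count_eq_zero, List.mem_cons]
        rintro (rfl | hmem)
        · exact hb rfl
        · exact hb (le_antisymm (hw.1 a hmem) (ha b List.mem_cons_self))
      rw [hcount]
      exact List.nil_prefix

theorem replicate_count_infix_of_pairwise_le (a : α) {w : List α} (hw : w.Pairwise (· ≤ ·)) :
    List.replicate (w.count a) a <:+: w := by
  induction w with
  | nil => simp
  | cons b w ih =>
    by_cases hb : a ≤ b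
    · refine (replicate_count_prefix_of_pairwise_le hw fun c hc => ?_).isInfix
      rcases List.mem_cons.1 hc with rfl | hc
      · exact hb
      · exact hb.trans ((List.pairwise_cons.1 hw).1 c hc)
    · rw [List.count_cons_of_ne (by rintro rfl; exact hb le_rfl)]
      exact (ih (List.pairwise_cons.1 hw).2).trans (List.suffix_cons b w).isInfix

end Lists

namespace AugPresentation

variable {𝕜 ι A : Type*} [Field 𝕜] [Ring A] [Algebra 𝕜 A]

theorem eval_append (S : AugPresentation 𝕜 ι A) (v w : List ι) :
    S.eval (v ++ w) = S.eval v * S.eval w := by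
  simp [eval]

variable [LinearOrder ι]

section WordOrder

variable {v w : List ι}

theorem WordLT.asymm (h : WordLT v w) : ¬ WordLT w v :=
  _root_.asymm (r := List.Shortlex (· < ·)) h

theorem WordLT.ne (h : WordLT v w) : v ≠ w := by
  rintro rfl
  exact h.asymm h

theorem wordLT_of_length_eq_of_lt (hl : v.length = w.length) (h : v < w) : WordLT v w :=
  List.Shortlex.of_lex hl h

theorem not_wordLT_of_perm_of_pairwise_le (h : v.Perm w) (hw : w.Pairwise (· ≤ ·)) :
    ¬ WordLT v w := fun hlt =>
  not_lt_of_perm_of_pairwise_le h hw ((List.shortlex_iff_lex h.length_eq).1 hlt)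

theorem WordLT.append_left (h : WordLT v w) (p : List ι) : WordLT (p ++ v) (p ++ w) :=
  List.Shortlex.append_left h p

theorem WordLT.append_right (h : WordLT v w) (q : List ι) : WordLT (v ++ q) (w ++ q) := by
  rcases List.shortlex_def.1 h with hlt | ⟨hl, hlex⟩
  · exact List.Shortlex.of_length_lt (by simpa using hlt)
  · refine List.Shortlex.of_lex (by simpa using hl) ?_
    clear h
    induction hlex with
    | nil => simp at hl
    | rel hab => exact List.Lex.rel hab
    | cons _ ih => exact List.Lex.cons (ih (by simpa using hl))

theorem wordLT_append_cons {a c : ι} (hac : a < c) (p : List ι)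
    (h : v.length = w.length) : WordLT (p ++ a :: v) (p ++ c :: w) :=
  WordLT.append_left (List.Shortlex.of_lex (by simpa using h) (List.Lex.rel hac)) p

end WordOrder

section Words

variable {S : AugPresentation 𝕜 ι A}

theorem isNormal_nil : S.IsNormal [] := by
  have : Nontrivial A := S.aug.toRingHom.domain_nontrivial
  simp [IsNormal, eval, WordLT]

theorem not_isNormal_of_eval_eq_zero {w : List ι} (h : S.eval w = 0) : ¬ S.IsNormal w :=
  fun hw => hw (h ▸ Submodule.zero_mem _)

theorem not_isNormal_of_eval_eq {v w : List ι} (hlt : WordLT v w) (h : S.eval v = S.eval w) :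
    ¬ S.IsNormal w :=
  fun hw => hw (Submodule.subset_span ⟨v, hlt, h⟩)

theorem IsNormal.of_infix {v w : List ι} (hw : S.IsNormal w) (h : v <:+: w) : S.IsNormal v := by
  obtain ⟨p, q, rfl⟩ := h
  refine fun hv => hw ?_
  have hle : Submodule.span 𝕜 (S.eval '' {v' | WordLT v' v}) ≤
      (Submodule.span 𝕜 (S.eval '' {w' | WordLT w' (p ++ v ++ q)})).comap
        (LinearMap.mulLeftRight 𝕜 (S.eval p, S.eval q)) := by
    rw [Submodule.span_le]
    rintro _ ⟨v', hv', rfl⟩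
    refine Submodule.subset_span ⟨p ++ v' ++ q, (hv'.append_left p).append_right q, ?_⟩
    simp [eval_append, mul_assoc]
  simpa [eval_append, mul_assoc] using hle hv

theorem IsTip.eq_of_infix {s t : List ι} (hs : S.IsTip s) (ht : S.IsTip t) (h : s <:+: t) :
    s = t := by
  by_contra hne
  exact hs.1 (ht.2 s h hne)

theorem exists_isTip_infix {w : List ι} (hw : ¬ S.IsNormal w) : ∃ t, S.IsTip t ∧ t <:+: w := by
  induction hl : w.length using Nat.strong_induction_on generalizing w with
  | _ l ih =>
    by_cases ht : S.IsTip w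
    · exact ⟨w, ht, List.infix_rfl⟩
    · obtain ⟨v, hvw, hne, hv⟩ : ∃ v, v <:+: w ∧ v ≠ w ∧ ¬ S.IsNormal v := by
        simpa [IsTip, hw] using ht
      have hlt : v.length < l := hl ▸ hvw.length_le.lt_of_ne fun h => hne (hvw.eq_of_length h)
      obtain ⟨t, ht, htv⟩ := ih _ hlt hv rfl
      exact ⟨t, ht, htv.trans hvw⟩

theorem IsTipPrefix.isNormal {g : List ι} (hg : S.IsTipPrefix g) : S.IsNormal g := by
  obtain ⟨t, ht, hgt, hne⟩ := hg
  exact ht.2 g hgt.isInfix hne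

theorem arrow_iff {f g : List ι} :
    S.Arrow f g ↔ S.IsTipPrefix g ∧ ¬ S.IsNormal (g ++ f) ∧ S.IsNormal (g ++ f).tail := by
  refine and_congr_right fun _ => ⟨?_, fun ⟨hn, htail⟩ => ?_⟩
  · rintro ⟨t, ht, htp, huniq⟩
    have hn : ¬ S.IsNormal (g ++ f) := fun h => ht.1 (h.of_infix htp.isInfix)
    refine ⟨hn, ?_⟩
    by_contra htail
    obtain ⟨t', ht', p, q, hpq⟩ := exists_isTip_infix htail
    cases hgf : g ++ f with
    | nil => exact hn (hgf ▸ isNormal_nil)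
    | cons a l =>
      rw [hgf, List.tail_cons] at hpq
      exact List.cons_ne_nil a p (huniq (a :: p) t' q ht' (by simp [hgf, ← hpq])).1
  · have hnil : ∀ p t q, S.IsTip t → g ++ f = p ++ t ++ q → p = [] := by
      intro p t q ht hpq
      by_contra hp
      refine ht.1 (htail.of_infix ⟨p.tail, q, ?_⟩)
      rw [hpq, List.append_assoc, List.append_assoc, List.tail_append_of_ne_nil hp]
    obtain ⟨t, ht, p, q, hpq⟩ := exists_isTip_infix hn
    obtain rfl := hnil p t q ht hpq.symm
    refine ⟨t, ht, ⟨q, hpq⟩, fun p' t' q' ht' hpq' => ?_⟩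
    obtain rfl := hnil p' t' q' ht' hpq'
    refine ⟨rfl, ?_⟩
    rcases List.prefix_or_prefix_of_prefix ⟨q', hpq'.symm⟩ ⟨q, hpq⟩ with h | h
    · exact ht'.eq_of_infix ht h.isInfix
    · exact (ht.eq_of_infix ht' h.isInfix).symm

theorem Arrow.eq_of_suffix {f g g' : List ι} (h : S.Arrow f g) (h' : S.Arrow f g')
    (hs : g <:+ g') : g = g' := by
  obtain ⟨p, rfl⟩ := hs
  cases p with
  | nil => rfl
  | cons a p =>
    refine absurd ((arrow_iff.1 h').2.2.of_infix ?_) (arrow_iff.1 h).2.1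
    exact ⟨p, [], by simp⟩

end Words

section Chains

variable {S : AugPresentation 𝕜 ι A} {n : ℕ}

theorem Chain.cons_top_tail (u : S.Chain (n + 1)) : u.1 = u.top :: u.tail.1 :=
  (List.cons_head_tail _).symm

theorem Chain.word_eq_top_append (u : S.Chain (n + 1)) : u.word = u.top ++ u.tail.word := by
  rw [Chain.word, u.cons_top_tail, List.flatten_cons, Chain.word]

theorem Chain.ext_top_tail {u u' : S.Chain (n + 1)} (htop : u.top = u'.top)
    (htail : u.tail = u'.tail) : u = u' :=
  Subtype.ext (by rw [u.cons_top_tail, u'.cons_top_tail, htop, htail])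

theorem Chain.arrow_top (u : S.Chain (n + 2)) : S.Arrow u.tail.top u.top := by
  have h := u.2.2
  rw [u.cons_top_tail, u.tail.cons_top_tail] at h
  exact h.1

theorem Chain.eq_of_append_top_eq {u u' : S.Chain (n + 2)} {v v' : List ι}
    (htail : u.tail = u'.tail) (h : v ++ u.top = v' ++ u'.top) : u = u' ∧ v = v' := by
  have ha := u.arrow_top
  have ha' := u'.arrow_top
  rw [← htail] at ha'
  have htop : u.top = u'.top := by
    have hs : u.top <:+ v ++ u.top := List.suffix_append _ _
    have hs' : u'.top <:+ v ++ u.top := h ▸ List.suffix_append _ _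
    rcases List.suffix_or_suffix_of_suffix hs hs' with hs | hs
    · exact ha.eq_of_suffix ha' hs
    · exact (ha'.eq_of_suffix ha hs).symm
  rw [htop] at h
  exact ⟨Chain.ext_top_tail htop htail, List.append_cancel_right h⟩

end Chains

section Terms

variable {S : AugPresentation 𝕜 ι A} {n : ℕ}

theorem eval_smul_ten (v w : List ι) (u : S.Chain n) : S.eval v • S.ten w u = S.ten (v ++ w) u := by
  rw [ten, ten, Finsupp.smul_single, smul_eq_mul, eval_append]

theorem ten_eq_eval_smul_single (v : List ι) (u : S.Chain n) :
    S.ten v u = S.eval v • Finsupp.single u 1 := by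
  rw [ten, Finsupp.smul_single_one]

variable [Finite ι]

theorem normalBasis_apply (r : S.NormalWord) : S.normalBasis r = S.eval r.1 := by
  simp [normalBasis]

theorem coeff_zero (r : S.NormalWord) (u : S.Chain n) : S.coeff 0 r u = 0 := by
  simp [coeff]

theorem coeff_add (x y : S.Free n) (r : S.NormalWord) (u : S.Chain n) :
    S.coeff (x + y) r u = S.coeff x r u + S.coeff y r u := by
  simp [coeff]

theorem coeff_smul (c : 𝕜) (x : S.Free n) (r : S.NormalWord) (u : S.Chain n) :
    S.coeff (c • x) r u = c * S.coeff x r u := by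
  simp [coeff]

theorem coeff_ten_self (r : S.NormalWord) (u : S.Chain n) : S.coeff (S.ten r.1 u) r u = 1 := by
  rw [coeff, ten, Finsupp.single_eq_same, ← normalBasis_apply, Module.Basis.repr_self,
    Finsupp.single_eq_same]

theorem coeff_ten_of_ne {r r' : S.NormalWord} {u u' : S.Chain n} (h : (r', u') ≠ (r, u)) :
    S.coeff (S.ten r.1 u) r' u' = 0 := by
  rw [coeff, ten, ← normalBasis_apply]
  rcases eq_or_ne u' u with rfl | hu
  · rw [Finsupp.single_eq_same, Module.Basis.repr_self, Finsupp.single_eq_of_ne]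
    rintro rfl
    exact h rfl
  · rw [Finsupp.single_eq_of_ne hu, map_zero, Finsupp.zero_apply]

/-- All terms `c r ⊗ u` of `x` have a word `ru` smaller than `w`: the condition on the lower terms
in the choice of a highest term. -/
def Below (x : S.Free n) (w : List ι) : Prop :=
  ∀ (r : S.NormalWord) (u : S.Chain n), S.coeff x r u ≠ 0 → WordLT (r.1 ++ u.word) w

theorem below_zero (w : List ι) : Below (0 : S.Free n) w :=
  fun r u h => absurd (coeff_zero r u) h

theorem Below.add {x y : S.Free n} {w : List ι} (hx : Below x w) (hy : Below y w) :
    Below (x + y) w := by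
  intro r u h
  rw [coeff_add] at h
  by_cases h' : S.coeff x r u = 0
  · exact hy r u fun hy' => h (by rw [h', hy', add_zero])
  · exact hx r u h'

theorem Below.smul {x : S.Free n} {w : List ι} (hx : Below x w) (c : 𝕜) : Below (c • x) w :=
  fun r u h => hx r u (right_ne_zero_of_mul (coeff_smul c x r u ▸ h))

theorem below_ten {v w : List ι} {u : S.Chain n} (hv : S.IsNormal v)
    (h : WordLT (v ++ u.word) w) : Below (S.ten v u) w := by
  intro r' u' hne
  by_cases heq : (r', u') = (⟨v, hv⟩, u)
  · cases heq
    exact h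
  · exact absurd (coeff_ten_of_ne heq) hne

theorem coeff_smul_ten_add {r : S.NormalWord} {u : S.Chain n} {x : S.Free n}
    (hx : Below x (r.1 ++ u.word)) (c : 𝕜) : S.coeff (c • S.ten r.1 u + x) r u = c := by
  have h0 : S.coeff x r u = 0 := by
    by_contra h
    exact (hx r u h).ne rfl
  rw [coeff_add, coeff_smul, coeff_ten_self, h0, mul_one, add_zero]

theorem isHighest_smul_ten_add {r : S.NormalWord} {u : S.Chain n} {x : S.Free n}
    (hx : Below x (r.1 ++ u.word)) {c : 𝕜} (hc : c ≠ 0) :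
    S.IsHighest (c • S.ten r.1 u + x) r u := by
  refine ⟨(coeff_smul_ten_add hx c).symm ▸ hc, fun r' u' h hne => hx r' u' ?_⟩
  rwa [coeff_add, coeff_smul, coeff_ten_of_ne hne, mul_zero, zero_add] at h

theorem IsHighest.unique {x : S.Free n} {r r' : S.NormalWord} {u u' : S.Chain n}
    (h : S.IsHighest x r u) (h' : S.IsHighest x r' u') : r = r' ∧ u = u' := by
  by_contra hne
  have hne' : (r, u) ≠ (r', u') := fun e => hne (Prod.ext_iff.1 e)
  exact (h.2 _ _ h'.1 hne'.symm).asymm (h'.2 _ _ h.1 hne')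

end Terms

section Reduction

variable [Finite ι] {S : AugPresentation 𝕜 ι A} {n : ℕ}
variable {d : S.Free (n + 2) →ₗ[A] S.Free (n + 1)} {x : S.Free (n + 1)} {z z' : S.Free (n + 2)}

theorem Reduces.eq_zero_or_eq_add (h : S.Reduces d x z) :
    (x = 0 ∧ z = 0) ∨ ∃ (y : S.Free (n + 2)) (r : S.NormalWord) (v : List ι) (u : S.Chain (n + 2)),
      r.1 = v ++ u.top ∧ S.IsHighest x r u.tail ∧
        S.Reduces d (x - d (S.coeff x r u.tail • S.ten v u)) y ∧
        z = S.coeff x r u.tail • S.ten v u + y := by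
  cases h with
  | zero => exact Or.inl ⟨rfl, rfl⟩
  | step _ y r v u hr hx hy => exact Or.inr ⟨y, r, v, u, hr, hx, hy, rfl⟩

theorem Reduces.unique (h : S.Reduces d x z) (h' : S.Reduces d x z') : z = z' := by
  induction h generalizing z' with
  | zero =>
    rcases h'.eq_zero_or_eq_add with ⟨-, rfl⟩ | ⟨y, r, v, u, -, hx, -⟩
    · rfl
    · exact absurd (coeff_zero _ _) hx.1
  | step x y r v u hr hx hy ih =>
    rcases h'.eq_zero_or_eq_add with ⟨rfl, -⟩ | ⟨y', r', v', u', hr', hx', hy', rfl⟩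
    · exact absurd (coeff_zero _ _) hx.1
    · obtain ⟨rfl, htail⟩ := hx.unique hx'
      obtain ⟨rfl, rfl⟩ := Chain.eq_of_append_top_eq htail (hr.symm.trans hr')
      rw [ih hy']

theorem Reduces.reduce_eq (h : S.Reduces d x z) : S.reduce d x = z := by
  have hex : ∃ y, S.Reduces d x y := ⟨z, h⟩
  rw [reduce, dif_pos hex]
  exact hex.choose_spec.unique h

theorem reduces_boundary_smul_ten_add {c : 𝕜} (hc : c ≠ 0) {v : List ι} {u : S.Chain (n + 2)}
    (hr : S.IsNormal (v ++ u.top))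
    (hd : d (c • S.ten v u + z) = c • S.ten (v ++ u.top) u.tail + x)
    (hx : Below x (v ++ u.word)) (hz : S.Reduces d (d z) z) :
    S.Reduces d (d (c • S.ten v u + z)) (c • S.ten v u + z) := by
  let r : S.NormalWord := ⟨v ++ u.top, hr⟩
  rw [u.word_eq_top_append, ← List.append_assoc] at hx
  have hcoeff : S.coeff (d (c • S.ten v u + z)) r u.tail = c := by
    rw [hd]
    exact coeff_smul_ten_add (r := r) hx c
  have hhighest : S.IsHighest (d (c • S.ten v u + z)) r u.tail := by
    rw [hd]
    exact isHighest_smul_ten_add (r := r) hx hc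
  have hrest : S.Reduces d (d (c • S.ten v u + z) -
      d (S.coeff (d (c • S.ten v u + z)) r u.tail • S.ten v u)) z := by
    rwa [hcoeff, map_add, add_sub_cancel_left]
  simpa only [hcoeff] using Reduces.step _ z r v u rfl hhighest hrest

end Reduction

section Stages

variable [Finite ι] {S : AugPresentation 𝕜 ι A} {n : ℕ}

theorem stage_s_zero (n : ℕ) : (S.stage n).s 0 = 0 := by
  induction n with
  | zero => simp [stage]
  | succ n ih =>
    change S.reduce _ (0 - (S.stage n).s ((S.stage n).d 0)) = 0
    rw [map_zero, ih, sub_zero]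
    exact Reduces.zero.reduce_eq

theorem stage_succ_s_of_ker {b : S.Free (n + 1)} (hb : (S.stage n).d b = 0) :
    (S.stage (n + 1)).s b = S.reduce (S.stage (n + 1)).d b := by
  change S.reduce _ (b - (S.stage n).s ((S.stage n).d b)) = _
  rw [hb, stage_s_zero, sub_zero]
  rfl

theorem stage_succ_d_single (u : S.Chain (n + 2)) :
    (S.stage (n + 1)).d (Finsupp.single u 1) =
      S.ten u.top u.tail - (S.stage n).s ((S.stage n).d (S.ten u.top u.tail)) := by
  change Finsupp.linearCombination A _ _ = _
  rw [Finsupp.linearCombination_single, one_smul]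

theorem stage_zero_d_single (u : S.Chain 1) :
    (S.stage 0).d (Finsupp.single u 1) = S.ten u.top S.nilChain := by
  change Finsupp.linearCombination A _ _ = _
  rw [Finsupp.linearCombination_single, one_smul]

theorem stage_zero_s_smul (c : 𝕜) (x : S.Free 0) :
    (S.stage 0).s (c • x) = c • (S.stage 0).s x :=
  S.sZero.map_smul c (x S.nilChain)

theorem sZero_eval_append_letter {v : List ι} {c : ι} (h : S.IsNormal (v ++ [c])) :
    S.sZero (S.eval (v ++ [c])) = S.ten v (S.letterChain c) := by
  let r : S.NormalWord := ⟨v ++ [c], h⟩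
  have hr : S.sZero (S.eval r.1) = S.sZeroWord r.1 := by
    rw [← normalBasis_apply r, sZero, Module.Basis.constr_basis]
  simpa [sZeroWord, r] using hr

theorem stage_zero_s_d_ten_letterChain {v : List ι} {c : ι} (h : S.IsNormal (v ++ [c])) :
    (S.stage 0).s ((S.stage 0).d (S.ten v (S.letterChain c))) = S.ten v (S.letterChain c) := by
  have hd : (S.stage 0).d (S.ten v (S.letterChain c)) = S.ten (v ++ [c]) S.nilChain := by
    rw [ten_eq_eval_smul_single, map_smul, stage_zero_d_single, eval_smul_ten]
    rfl
  rw [hd, ← sZero_eval_append_letter h]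
  exact congrArg S.sZero Finsupp.single_eq_same

/-- If the `D n` form a complex and the recursive rule recovers `z` from `D z`, where `z` is the
part that `D` has to cancel in `r ⊗ u'`, then the `D n` are the differentials of the resolution. -/
theorem stage_d_eq_of_reduces (D : ∀ n, S.Free (n + 1) →ₗ[A] S.Free n)
    (hDD : ∀ n x, D n (D (n + 1) x) = 0)
    (hzero : ∀ u : S.Chain 1, D 0 (Finsupp.single u 1) = S.ten u.top S.nilChain)
    (hone : ∀ (u : S.Chain 2) (z : S.Free 1), D 1 (Finsupp.single u 1) + z = S.ten u.top u.tail →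
      (S.stage 0).s ((S.stage 0).d z) = z)
    (hstep : ∀ (n : ℕ) (u : S.Chain (n + 3)) (z : S.Free (n + 2)),
      D (n + 2) (Finsupp.single u 1) + z = S.ten u.top u.tail →
        S.Reduces (D (n + 1)) (D (n + 1) z) z) :
    ∀ n, (S.stage n).d = D n := by
  have hsucc : ∀ n, (S.stage n).d = D n →
      (∀ (u : S.Chain (n + 2)) (z : S.Free (n + 1)),
        D (n + 1) (Finsupp.single u 1) + z = S.ten u.top u.tail →
          (S.stage n).s ((S.stage n).d z) = z) →
      (S.stage (n + 1)).d = D (n + 1) := by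
    refine fun n hn hs => Finsupp.lhom_ext' fun u => LinearMap.ext_ring ?_
    have hz := add_sub_cancel (D (n + 1) (Finsupp.single u 1)) (S.ten u.top u.tail)
    have hsz := hs u _ hz
    rw [hn, map_sub, hDD, sub_zero, ← hn] at hsz
    rw [LinearMap.comp_apply, Finsupp.lsingle_apply, stage_succ_d_single, hsz, sub_sub_cancel]
    rfl
  have hstage : ∀ n, (S.stage n).d = D n ∧ (S.stage (n + 1)).d = D (n + 1) := by
    intro n
    induction n with
    | zero =>
      have h0 : (S.stage 0).d = D 0 := Finsupp.lhom_ext' fun u => LinearMap.ext_ring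
        ((stage_zero_d_single u).trans (hzero u).symm)
      exact ⟨h0, hsucc 0 h0 hone⟩
    | succ n ih =>
      refine ⟨ih.2, hsucc (n + 1) ih.2 fun u z hz => ?_⟩
      rw [stage_succ_s_of_ker, ih.2]
      · exact (hstep n u z hz).reduce_eq
      · rw [ih.1, ih.2, hDD]
  exact fun n => (hstage n).1

end Stages

end AugPresentation

section TruncatedExponents

variable {m : ℕ} (hm : 2 ≤ m) (l : ℕ)

include hm in
theorem truncSigma_pos : 0 < truncSigma m l := by
  unfold truncSigma
  split <;> omega

include hm in
theorem truncSigma_lt : truncSigma m l < m := by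
  unfold truncSigma
  split <;> omega

include hm in
theorem truncSigma_succ_add : truncSigma m (l + 1) + truncSigma m l = m := by
  simp only [truncSigma, Nat.odd_add_one]
  split_ifs <;> omega

theorem truncSigma_one (m : ℕ) : truncSigma m 1 = 1 := if_pos odd_one

end TruncatedExponents

theorem truncVar₃_pow (𝕜 : Type*) [Field 𝕜] (m : Fin 3 → ℕ) (a : Fin 3) :
    truncVar₃ 𝕜 m a ^ m a = 0 := by
  rw [truncVar₃, ← map_pow, Ideal.Quotient.eq_zero_iff_mem]
  exact Ideal.subset_span ⟨a, rfl⟩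

namespace TruncAnick

open AugPresentation

section NormalWords

theorem coeff_eq_zero_of_mem_span_X_pow {R σ : Type*} [CommSemiring R] {m : σ → ℕ}
    {p : MvPolynomial σ R}
    (hp : p ∈ Ideal.span (Set.range fun a => (MvPolynomial.X a ^ m a : MvPolynomial σ R)))
    {e : σ →₀ ℕ} (he : ∀ a, e a < m a) : p.coeff e = 0 := by
  have hrange : (Set.range fun a => (MvPolynomial.X a ^ m a : MvPolynomial σ R)) =
      (fun s => MvPolynomial.monomial s (1 : R)) '' Set.range fun a => Finsupp.single a (m a) := by
    rw [← Set.range_comp]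
    exact congrArg Set.range (funext fun a => MvPolynomial.X_pow_eq_monomial)
  rw [hrange, MvPolynomial.mem_ideal_span_monomial_image] at hp
  by_contra hne
  obtain ⟨_, ⟨a, rfl⟩, hle⟩ := hp e (MvPolynomial.mem_support_iff.2 hne)
  exact (he a).not_ge (Finsupp.single_le_iff.1 hle)

variable {𝕜 : Type*} [Field 𝕜] {m : Fin 3 → ℕ} {hm : ∀ a, 2 ≤ m a}

theorem eval_replicate (a : Fin 3) (e : ℕ) :
    (truncPresentation 𝕜 m hm).eval (List.replicate e a) = truncVar₃ 𝕜 m a ^ e := by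
  simp [eval, truncPresentation]

theorem eval_eq_mk_monomial (w : List (Fin 3)) :
    (truncPresentation 𝕜 m hm).eval w =
      Ideal.Quotient.mk _ (MvPolynomial.monomial (Multiset.toFinsupp ↑w) (1 : 𝕜)) := by
  induction w with
  | nil => simp [eval]
  | cons a w ih =>
    have hcons : (truncPresentation 𝕜 m hm).eval (a :: w) =
        truncVar₃ 𝕜 m a * (truncPresentation 𝕜 m hm).eval w := by
      simp [eval, truncPresentation]
    rw [hcons, ih, truncVar₃, ← map_mul, MvPolynomial.X, MvPolynomial.monomial_mul, one_mul,
      ← Multiset.cons_coe, ← Multiset.singleton_add, map_add, Multiset.toFinsupp_singleton]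

theorem eval_eq_of_perm {v w : List (Fin 3)} (h : v.Perm w) :
    (truncPresentation 𝕜 m hm).eval v = (truncPresentation 𝕜 m hm).eval w :=
  (h.map _).prod_eq

theorem IsNormal.pairwise_le {w : List (Fin 3)} (hw : (truncPresentation 𝕜 m hm).IsNormal w) :
    w.Pairwise (· ≤ ·) := by
  have hsorted : (w.mergeSort (· ≤ ·)).Pairwise (· ≤ ·) := List.pairwise_mergeSort' _ _
  have hperm : (w.mergeSort (· ≤ ·)).Perm w := List.mergeSort_perm _ _
  by_contra hw'
  have hlt : w.mergeSort (· ≤ ·) < w :=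
    (not_lt.1 (not_lt_of_perm_of_pairwise_le hperm.symm hsorted)).lt_of_ne
      fun h => hw' (h ▸ hsorted)
  exact not_isNormal_of_eval_eq (wordLT_of_length_eq_of_lt hperm.length_eq hlt)
    (eval_eq_of_perm hperm) hw

theorem IsNormal.count_lt {w : List (Fin 3)} (hw : (truncPresentation 𝕜 m hm).IsNormal w)
    (a : Fin 3) : w.count a < m a := by
  by_contra! ha
  have hinfix : List.replicate (m a) a <:+: w :=
    (List.infix_replicate_iff.2 ⟨by simpa using ha, by simp⟩).trans
      (replicate_count_infix_of_pairwise_le a (IsNormal.pairwise_le hw))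
  exact not_isNormal_of_eval_eq_zero (by rw [eval_replicate, truncVar₃_pow]) (hw.of_infix hinfix)

theorem isNormal_of_pairwise_le_of_count_lt {w : List (Fin 3)} (hw : w.Pairwise (· ≤ ·))
    (hcount : ∀ a, w.count a < m a) : (truncPresentation 𝕜 m hm).IsNormal w := by
  intro hspan
  let q := Ideal.Quotient.mkₐ 𝕜 (Ideal.span (Set.range fun a : Fin 3 =>
    (MvPolynomial.X a ^ m a : MvPolynomial (Fin 3) 𝕜)))
  let e : Fin 3 →₀ ℕ := Multiset.toFinsupp ↑w
  have hle : Submodule.span 𝕜 ((truncPresentation 𝕜 m hm).eval '' {v | WordLT v w}) ≤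
      (LinearMap.ker (MvPolynomial.lcoeff 𝕜 e)).map q.toLinearMap := by
    rw [Submodule.span_le]
    rintro _ ⟨v, hv, rfl⟩
    refine ⟨_, ?_, (eval_eq_mk_monomial v).symm⟩
    rw [SetLike.mem_coe, LinearMap.mem_ker, MvPolynomial.lcoeff_apply,
      MvPolynomial.coeff_monomial, if_neg]
    intro heq
    have hperm : v.Perm w := Multiset.coe_eq_coe.1 (Multiset.toFinsupp.injective heq)
    exact not_wordLT_of_perm_of_pairwise_le hperm hw hv
  obtain ⟨p, hp, hpw⟩ := hle hspan
  rw [eval_eq_mk_monomial] at hpw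
  have hcoeff := coeff_eq_zero_of_mem_span_X_pow (Ideal.Quotient.eq.1 hpw) (e := e)
    (by simpa [e] using hcount)
  have hp0 : p.coeff e = 0 := hp
  rw [MvPolynomial.coeff_sub, hp0, MvPolynomial.coeff_monomial, if_pos rfl, zero_sub,
    neg_eq_zero] at hcoeff
  exact one_ne_zero hcoeff

theorem isNormal_replicate_append_replicate {a c : Fin 3} (hac : a < c) {e f : ℕ} (he : e < m a)
    (hf : f < m c) :
    (truncPresentation 𝕜 m hm).IsNormal (List.replicate e a ++ List.replicate f c) := by
  refine isNormal_of_pairwise_le_of_count_lt ?_ fun b => ?_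
  · simp only [List.pairwise_append, List.pairwise_replicate, le_refl, or_true, true_and]
    intro x hx y hy
    rw [List.eq_of_mem_replicate hx, List.eq_of_mem_replicate hy]
    exact hac.le
  · have hb := hm b
    simp only [List.count_append, List.count_replicate, beq_iff_eq]
    split_ifs with ha hc hc
    · exact absurd (ha.trans hc.symm) hac.ne
    · simpa [← ha] using he
    · simpa [← hc] using hf
    · lia

theorem isNormal_replicate_iff {a : Fin 3} {e : ℕ} :
    (truncPresentation 𝕜 m hm).IsNormal (List.replicate e a) ↔ e < m a := by
  refine ⟨fun h => by simpa using IsNormal.count_lt h a, fun he => ?_⟩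
  refine isNormal_of_pairwise_le_of_count_lt (List.pairwise_replicate.2 (Or.inr le_rfl))
    fun b => ?_
  have hb := hm b
  rw [List.count_replicate]
  split_ifs with hab
  · rwa [← beq_iff_eq.1 hab]
  · lia

end NormalWords

section Quiver

variable {𝕜 : Type*} [Field 𝕜] {m : Fin 3 → ℕ} {hm : ∀ a, 2 ≤ m a}

theorem isNormal_singleton (a : Fin 3) : (truncPresentation 𝕜 m hm).IsNormal [a] :=
  (isNormal_replicate_iff (e := 1)).2 (hm a)

theorem isTip_replicate (a : Fin 3) :
    (truncPresentation 𝕜 m hm).IsTip (List.replicate (m a) a) := by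
  refine ⟨fun h => lt_irrefl _ (isNormal_replicate_iff.1 h), fun v hv hne => ?_⟩
  obtain ⟨hl, h⟩ := List.infix_replicate_iff.1 hv
  rw [h, isNormal_replicate_iff]
  exact hl.lt_of_ne fun hl' => hne (by rw [h, hl'])

theorem isTip_pair {a c : Fin 3} (h : a < c) : (truncPresentation 𝕜 m hm).IsTip [c, a] := by
  refine ⟨fun hn => ?_, fun v hv hne => ?_⟩
  · exact (List.rel_of_pairwise_cons (IsNormal.pairwise_le hn) (by simp)).not_gt h
  · have hl : v.length < 2 := hv.length_le.lt_of_ne fun h => hne (hv.eq_of_length h)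
    match v, hl with
    | [], _ => exact isNormal_nil
    | [b], _ => exact isNormal_singleton b

theorem IsTip.eq_pair_or_eq_replicate {t : List (Fin 3)}
    (ht : (truncPresentation 𝕜 m hm).IsTip t) :
    (∃ a c, a < c ∧ t = [c, a]) ∨ ∃ a, t = List.replicate (m a) a := by
  by_cases hs : t.Pairwise (· ≤ ·)
  · obtain ⟨a, ha⟩ : ∃ a, m a ≤ t.count a := by
      by_contra! hcount
      exact ht.1 (isNormal_of_pairwise_le_of_count_lt hs hcount)
    have hinfix : List.replicate (m a) a <:+: t :=
      (List.infix_replicate_iff.2 ⟨by simpa using ha, by simp⟩).trans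
        (replicate_count_infix_of_pairwise_le a hs)
    exact Or.inr ⟨a, ((isTip_replicate a).eq_of_infix ht hinfix).symm⟩
  · obtain ⟨a, c, hac, hinfix⟩ := exists_infix_pair_of_not_pairwise_le hs
    exact Or.inl ⟨a, c, hac, ((isTip_pair hac).eq_of_infix ht hinfix).symm⟩

theorem IsTipPrefix.exists_eq_replicate {g : List (Fin 3)}
    (h : (truncPresentation 𝕜 m hm).IsTipPrefix g) : ∃ c e, g = List.replicate e c := by
  obtain ⟨t, ht, hgt, hne⟩ := h
  rcases IsTip.eq_pair_or_eq_replicate ht with ⟨a, c, -, rfl⟩ | ⟨a, rfl⟩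
  · have hl : g.length < 2 := hgt.length_le.lt_of_ne fun h => hne (hgt.eq_of_length h)
    match g, hl with
    | [], _ => exact ⟨c, 0, rfl⟩
    | [b], _ => exact ⟨b, 1, rfl⟩
  · exact ⟨a, g.length, (List.prefix_replicate_iff.1 hgt).2⟩

theorem isTipPrefix_replicate {a : Fin 3} {e : ℕ} (he : e < m a) :
    (truncPresentation 𝕜 m hm).IsTipPrefix (List.replicate e a) :=
  ⟨List.replicate (m a) a, isTip_replicate a,
    List.prefix_replicate_iff.2 ⟨by simpa using he.le, by simp⟩,
    fun h => he.ne (by simpa using congrArg List.length h)⟩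

theorem arrow_replicate_iff {a : Fin 3} {b : ℕ} (hb : 0 < b) (hba : b < m a) (g : List (Fin 3)) :
    (truncPresentation 𝕜 m hm).Arrow (List.replicate b a) g ↔
      g = List.replicate (m a - b) a ∨ ∃ c, a < c ∧ g = [c] := by
  have hf := isNormal_replicate_iff (𝕜 := 𝕜) (hm := hm).2 hba
  obtain ⟨b, rfl⟩ := Nat.exists_eq_add_one.2 hb
  rw [arrow_iff]
  constructor
  · rintro ⟨hg, hn, htail⟩
    obtain ⟨c, e, rfl⟩ := IsTipPrefix.exists_eq_replicate hg
    have he := isNormal_replicate_iff.1 hg.isNormal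
    rcases e with _ | e
    · exact absurd hf hn
    rcases lt_trichotomy c a with hca | rfl | hac
    · exact absurd (isNormal_replicate_append_replicate hca he hba) hn
    · rw [← List.replicate_add, List.tail_replicate, isNormal_replicate_iff] at htail
      rw [← List.replicate_add, isNormal_replicate_iff] at hn
      exact Or.inl (congrArg (List.replicate · c) (by lia))
    · rcases e with _ | e
      · exact Or.inr ⟨c, hac, rfl⟩
      · refine absurd (htail.of_infix ?_) (isTip_pair hac).1
        refine ⟨List.replicate e c, List.replicate b a, ?_⟩
        rw [List.replicate_succ (n := e + 1), List.cons_append, List.tail_cons,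
          List.replicate_succ' (n := e), List.replicate_succ (n := b)]
        simp
  · rintro (rfl | ⟨c, hac, rfl⟩)
    · rw [← List.replicate_add, List.tail_replicate, isNormal_replicate_iff,
        isNormal_replicate_iff]
      exact ⟨isTipPrefix_replicate (by lia), by lia, by lia⟩
    · refine ⟨⟨[c, a], isTip_pair hac, ⟨[a], rfl⟩, by simp⟩, fun h => ?_, hf⟩
      exact (isTip_pair hac).1 (h.of_infix ⟨[], List.replicate b a, by simp [List.replicate_succ]⟩)

end Quiver

section Paths

/-- The vertex `a ^ σ(l)` of the paths `u_{ijk}`. -/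
def sigmaWord (m : Fin 3 → ℕ) (a : Fin 3) (l : ℕ) : List (Fin 3) :=
  List.replicate (truncSigma (m a) l) a

variable {m : Fin 3 → ℕ}

theorem triPath_succ_right (i j k : ℕ) :
    triPath m i j (k + 1) = sigmaWord m 2 (k + 1) :: triPath m i j k := rfl

theorem triPath_succ_mid (i j : ℕ) :
    triPath m i (j + 1) 0 = sigmaWord m 1 (j + 1) :: triPath m i j 0 := rfl

theorem triPath_succ_left (i : ℕ) :
    triPath m (i + 1) 0 0 = sigmaWord m 0 (i + 1) :: triPath m i 0 0 := rfl

theorem length_powPath (a : Fin 3) (m l : ℕ) : (powPath a m l).length = l := by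
  induction l with
  | zero => rfl
  | succ l ih => rw [powPath, List.length_cons, ih]

theorem length_triPath (i j k : ℕ) : (triPath m i j k).length = i + j + k := by
  simp only [triPath, List.length_append, length_powPath]
  lia

theorem countP_head_powPath {m : ℕ} (hm : 2 ≤ m) (a b : Fin 3) (l : ℕ) :
    (powPath a m l).countP (fun f => f.head? == some b) = if a = b then l else 0 := by
  induction l with
  | zero => simp [powPath]
  | succ l ih =>
    obtain ⟨e, he⟩ := Nat.exists_eq_add_one.2 (truncSigma_pos hm (l + 1))
    rw [powPath, List.countP_cons, ih, he]
    by_cases h : a = b <;> simp [h, List.replicate_succ]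

theorem triPath_injective (hm : ∀ a, 2 ≤ m a) {i j k i' j' k' : ℕ}
    (h : triPath m i j k = triPath m i' j' k') : i = i' ∧ j = j' ∧ k = k' := by
  have hcount := fun b => congrArg (List.countP (fun f => f.head? == some b)) h
  simp only [triPath, List.countP_append, countP_head_powPath (hm _)] at hcount
  exact ⟨by simpa using hcount 0, by simpa using hcount 1, by simpa using hcount 2⟩

variable {𝕜 : Type*} [Field 𝕜] {hm : ∀ a, 2 ≤ m a}

theorem arrow_sigmaWord_iff {a : Fin 3} {l : ℕ} (g : List (Fin 3)) :
    (truncPresentation 𝕜 m hm).Arrow (sigmaWord m a l) g ↔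
      g = sigmaWord m a (l + 1) ∨
        ∃ c, a < c ∧ g = sigmaWord m c 1 := by
  have hsub : m a - truncSigma (m a) l = truncSigma (m a) (l + 1) := by
    have := truncSigma_succ_add (hm a) l
    lia
  simp only [sigmaWord, arrow_replicate_iff (truncSigma_pos (hm a) l) (truncSigma_lt (hm a) l),
    hsub, truncSigma_one, List.replicate_one]

theorem isPath_cons_triPath_iff {g : List (Fin 3)} {i j k : ℕ} :
    (truncPresentation 𝕜 m hm).IsPath (g :: triPath m i j k) ↔
      (truncPresentation 𝕜 m hm).IsPath (triPath m i j k) ∧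
        (g = sigmaWord m 2 (k + 1) ∨
          k = 0 ∧ g = sigmaWord m 1 (j + 1) ∨
          k = 0 ∧ j = 0 ∧ g = sigmaWord m 0 (i + 1)) := by
  rcases k with _ | k
  · rcases j with _ | j
    · rcases i with _ | i
      · have hnil : triPath m 0 0 0 = [] := rfl
        simp only [hnil, IsPath, Fin.exists_fin_succ, Fin.succ_zero_eq_one, Fin.succ_one_eq_two,
          IsEmpty.exists_iff, or_false, zero_add, true_and]
        tauto
      · rw [triPath_succ_left, IsPath, arrow_sigmaWord_iff]
        simp only [Fin.exists_fin_succ, lt_self_iff_false, false_and, Fin.succ_pos, true_and,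
          Fin.succ_zero_eq_one, Fin.succ_one_eq_two, IsEmpty.exists_iff, or_false,
          false_or, zero_add]
        tauto
    · rw [triPath_succ_mid, IsPath, arrow_sigmaWord_iff]
      simp only [Fin.exists_fin_succ, not_lt_zero, false_and, Fin.succ_zero_eq_one,
        lt_self_iff_false, Fin.succ_one_eq_two, Fin.reduceLT, true_and, IsEmpty.exists_iff,
        or_false, false_or, zero_add, Nat.add_eq_zero_iff, one_ne_zero, and_false]
      tauto
  · rw [triPath_succ_right, IsPath, arrow_sigmaWord_iff]
    simp only [Fin.exists_fin_succ, not_lt_zero, false_and, Fin.succ_zero_eq_one, Fin.lt_one_iff,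
      Fin.reduceEq, Fin.succ_one_eq_two, lt_self_iff_false, IsEmpty.exists_iff, or_self, or_false,
      Nat.add_eq_zero_iff, one_ne_zero, and_false]
    tauto

theorem isPath_triPath (i j k : ℕ) : (truncPresentation 𝕜 m hm).IsPath (triPath m i j k) := by
  induction k with
  | zero =>
    induction j with
    | zero =>
      induction i with
      | zero => trivial
      | succ i ih => exact isPath_cons_triPath_iff.2 ⟨ih, Or.inr (Or.inr ⟨rfl, rfl, rfl⟩)⟩
    | succ j ih => exact isPath_cons_triPath_iff.2 ⟨ih, Or.inr (Or.inl ⟨rfl, rfl⟩)⟩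
  | succ k ih => exact isPath_cons_triPath_iff.2 ⟨ih, Or.inl rfl⟩

theorem IsPath.exists_eq_triPath {p : List (List (Fin 3))}
    (hp : (truncPresentation 𝕜 m hm).IsPath p) : ∃ i j k, p = triPath m i j k := by
  induction p with
  | nil => exact ⟨0, 0, 0, rfl⟩
  | cons g p ih =>
    have hp' : (truncPresentation 𝕜 m hm).IsPath p := by
      cases p with
      | nil => trivial
      | cons f p => exact hp.2
    obtain ⟨i, j, k, rfl⟩ := ih hp'
    rcases (isPath_cons_triPath_iff.1 hp).2 with rfl | ⟨rfl, rfl⟩ | ⟨rfl, rfl, rfl⟩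
    · exact ⟨i, j, k + 1, rfl⟩
    · exact ⟨i, j + 1, 0, rfl⟩
    · exact ⟨i + 1, 0, 0, rfl⟩

theorem isChain_triPath {n i j k : ℕ} (h : i + j + k = n) :
    (truncPresentation 𝕜 m hm).IsChain n (triPath m i j k) :=
  ⟨by rw [length_triPath, h], isPath_triPath i j k⟩

theorem isChain_iff_existsUnique (n : ℕ) (p : List (List (Fin 3))) :
    (truncPresentation 𝕜 m hm).IsChain n p ↔
      ∃! t : TriDeg n, p = triPath m t.1.1 t.1.2.1 t.1.2.2 := by
  constructor
  · rintro ⟨hl, hp⟩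
    obtain ⟨i, j, k, rfl⟩ := IsPath.exists_eq_triPath hp
    refine ⟨⟨(i, j, k), (length_triPath i j k).symm.trans hl⟩, rfl, ?_⟩
    rintro ⟨⟨i', j', k'⟩, h'⟩ h
    obtain ⟨rfl, rfl, rfl⟩ := triPath_injective hm h
    rfl
  · rintro ⟨⟨_, h⟩, rfl, -⟩
    exact isChain_triPath h

end Paths

end TruncAnick

section TripleComplex

variable {R : Type*} [CommRing R]

/-- The total differential of a triple complex with all components `R` whose differentials in the
three directions are the multiplications by `y k`, `x j` and `w i`. -/
def triD (y x w : ℕ → R) (n : ℕ) : (TriDeg (n + 1) → R) →ₗ[R] (TriDeg n → R) where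
  toFun f t :=
    have ht : t.1.1 + t.1.2.1 + t.1.2.2 = n := t.2
    y (t.1.2.2 + 1) * f ⟨(t.1.1, t.1.2.1, t.1.2.2 + 1), by lia⟩ +
    (-1) ^ t.1.2.2 * (x (t.1.2.1 + 1) * f ⟨(t.1.1, t.1.2.1 + 1, t.1.2.2), by lia⟩) +
    (-1) ^ (t.1.2.2 + t.1.2.1) * (w (t.1.1 + 1) * f ⟨(t.1.1 + 1, t.1.2.1, t.1.2.2), by lia⟩)
  map_add' f g := by
    ext t
    simp only [Pi.add_apply]
    ring
  map_smul' c f := by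
    ext t
    simp only [Pi.smul_apply, smul_eq_mul, RingHom.id_apply]
    ring

variable {y x w : ℕ → R}

theorem triD_apply {n i j k : ℕ} (h : i + j + k = n) (f : TriDeg (n + 1) → R) :
    triD y x w n f ⟨(i, j, k), h⟩ =
      y (k + 1) * f ⟨(i, j, k + 1), by lia⟩ +
      (-1) ^ k * (x (j + 1) * f ⟨(i, j + 1, k), by lia⟩) +
      (-1) ^ (k + j) * (w (i + 1) * f ⟨(i + 1, j, k), by lia⟩) := rfl

theorem triD_triD (hy : ∀ l, y (l + 1) * y l = 0) (hx : ∀ l, x (l + 1) * x l = 0)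
    (hw : ∀ l, w (l + 1) * w l = 0) (n : ℕ) (f : TriDeg (n + 2) → R) :
    triD y x w n (triD y x w (n + 1) f) = 0 := by
  ext ⟨⟨i, j, k⟩, h⟩
  simp only [triD_apply, Pi.zero_apply]
  linear_combination f ⟨(i, j, k + 2), by lia⟩ * hy (k + 1) +
    ((-1) ^ k) ^ 2 * f ⟨(i, j + 2, k), by lia⟩ * hx (j + 1) +
    ((-1) ^ (k + j)) ^ 2 * f ⟨(i + 2, j, k), by lia⟩ * hw (i + 1)

end TripleComplex

instance (n : ℕ) : Finite (TriDeg n) := by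
  refine Finite.of_injective (β := Fin (n + 1) × Fin (n + 1) × Fin (n + 1))
    (fun t => have ht : t.1.1 + t.1.2.1 + t.1.2.2 = n := t.2
      (⟨t.1.1, by lia⟩, ⟨t.1.2.1, by lia⟩, ⟨t.1.2.2, by lia⟩)) ?_
  rintro ⟨⟨i, j, k⟩, h⟩ ⟨⟨i', j', k'⟩, h'⟩ he
  simpa using he

namespace TruncAnick

open AugPresentation

section Coordinates

variable {𝕜 : Type*} [Field 𝕜] {m : Fin 3 → ℕ} {hm : ∀ a, 2 ≤ m a}

variable (𝕜 hm) in
/-- The path `u_{ijk}` as an element of `C_n`. -/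
def triChain {n i j k : ℕ} (h : i + j + k = n) : (truncPresentation 𝕜 m hm).Chain n :=
  ⟨triPath m i j k, isChain_triPath h⟩

theorem exists_eq_triChain {n : ℕ} (u : (truncPresentation 𝕜 m hm).Chain n) :
    ∃ (i j k : ℕ) (h : i + j + k = n), u = triChain 𝕜 hm h := by
  obtain ⟨⟨⟨i, j, k⟩, h⟩, hu, -⟩ := (isChain_iff_existsUnique n u.1).1 u.2
  exact ⟨i, j, k, h, Subtype.ext hu⟩

variable (𝕜 hm) in
/-- The bijection `(i, j, k) ↦ u_{ijk}` between the triples of sum `n` and `C_n`. -/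
noncomputable def chainEquiv (n : ℕ) : TriDeg n ≃ (truncPresentation 𝕜 m hm).Chain n :=
  Equiv.ofBijective (fun t => triChain 𝕜 hm t.2) <| by
    constructor
    · rintro ⟨⟨i, j, k⟩, h⟩ ⟨⟨i', j', k'⟩, h'⟩ he
      obtain ⟨rfl, rfl, rfl⟩ := triPath_injective hm (congrArg Subtype.val he)
      rfl
    · intro u
      obtain ⟨i, j, k, h, rfl⟩ := exists_eq_triChain u
      exact ⟨⟨(i, j, k), h⟩, rfl⟩

variable (𝕜 hm) in
/-- The coordinates on `P_n` with respect to the basis of the `1 ⊗ u_{ijk}`. -/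
noncomputable def coords (n : ℕ) :
    (truncPresentation 𝕜 m hm).Free n ≃ₗ[TruncPoly₃ 𝕜 m] (TriDeg n → TruncPoly₃ 𝕜 m) :=
  Finsupp.domLCongr (chainEquiv 𝕜 hm n).symm ≪≫ₗ
    Finsupp.linearEquivFunOnFinite (TruncPoly₃ 𝕜 m) (TruncPoly₃ 𝕜 m) (TriDeg n)

theorem coords_apply {n : ℕ} (x : (truncPresentation 𝕜 m hm).Free n) (t : TriDeg n) :
    coords 𝕜 hm n x t = x (triChain 𝕜 hm t.2) := rfl

theorem uElt_natCast {n i j k : ℕ} (h : i + j + k = n) :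
    uElt 𝕜 m hm n i j k = Finsupp.single (triChain 𝕜 hm h) 1 :=
  dif_pos ⟨by simp, isChain_triPath h⟩

theorem uElt_eq_zero {n : ℕ} {i j k : ℤ} (h : i < 0 ∨ j < 0 ∨ k < 0) :
    uElt 𝕜 m hm n i j k = 0 :=
  dif_neg fun h' => by lia

theorem coords_uElt {n : ℕ} (i j k : ℤ) (t : TriDeg n) :
    coords 𝕜 hm n (uElt 𝕜 m hm n i j k) t =
      if (t.1.1 : ℤ) = i ∧ (t.1.2.1 : ℤ) = j ∧ (t.1.2.2 : ℤ) = k then 1 else 0 := by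
  rw [coords_apply, uElt]
  split_ifs with h1 h2 h2
  · obtain ⟨rfl, rfl, rfl⟩ := h2
    exact Finsupp.single_eq_same
  · refine Finsupp.single_eq_of_ne fun he => ?_
    obtain ⟨e1, e2, e3⟩ := triPath_injective hm (congrArg Subtype.val he)
    lia
  · obtain ⟨rfl, rfl, rfl⟩ := h2
    exact absurd ⟨⟨by simp, by simp, by simp⟩, isChain_triPath t.2⟩ h1
  · rfl

variable (𝕜 m) in
/-- The power `a ^ σ(l)` in `A` of the variable with index `a`. -/
noncomputable def sigmaPow (a : Fin 3) (l : ℕ) : TruncPoly₃ 𝕜 m :=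
  truncVar₃ 𝕜 m a ^ truncSigma (m a) l

theorem sigmaPow_succ_mul (hm : ∀ a, 2 ≤ m a) (a : Fin 3) (l : ℕ) :
    sigmaPow 𝕜 m a (l + 1) * sigmaPow 𝕜 m a l = 0 := by
  rw [sigmaPow, sigmaPow, ← pow_add, truncSigma_succ_add (hm a), truncVar₃_pow]

variable (𝕜 hm) in
/-- The differential `P_{n+1} → P_n` that is given in coordinates by the signed multiplications by
the powers `y ^ σ(k)`, `x ^ σ(j)` and `w ^ σ(i)`. -/
noncomputable def triDiff (n : ℕ) : (truncPresentation 𝕜 m hm).Free (n + 1) →ₗ[TruncPoly₃ 𝕜 m]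
    (truncPresentation 𝕜 m hm).Free n :=
  (coords 𝕜 hm n).symm.toLinearMap ∘ₗ
    triD (sigmaPow 𝕜 m 2) (sigmaPow 𝕜 m 1) (sigmaPow 𝕜 m 0) n ∘ₗ
      (coords 𝕜 hm (n + 1)).toLinearMap

theorem coords_triDiff (n : ℕ) (x : (truncPresentation 𝕜 m hm).Free (n + 1)) :
    coords 𝕜 hm n (triDiff 𝕜 hm n x) =
      triD (sigmaPow 𝕜 m 2) (sigmaPow 𝕜 m 1) (sigmaPow 𝕜 m 0) n (coords 𝕜 hm (n + 1) x) :=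
  (coords 𝕜 hm n).apply_symm_apply _

theorem triDiff_triDiff (n : ℕ) (x : (truncPresentation 𝕜 m hm).Free (n + 2)) :
    triDiff 𝕜 hm n (triDiff 𝕜 hm (n + 1) x) = 0 := by
  apply (coords 𝕜 hm n).injective
  rw [coords_triDiff, coords_triDiff, map_zero,
    triD_triD (sigmaPow_succ_mul hm 2) (sigmaPow_succ_mul hm 1) (sigmaPow_succ_mul hm 0)]

theorem triDiff_uElt {n i j k : ℕ} :
    triDiff 𝕜 hm n (uElt 𝕜 m hm (n + 1) i j k) =
      sigmaPow 𝕜 m 2 k • uElt 𝕜 m hm n i j ((k : ℤ) - 1) +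
      ((-1) ^ k * sigmaPow 𝕜 m 1 j) • uElt 𝕜 m hm n i ((j : ℤ) - 1) k +
      ((-1) ^ (j + k) * sigmaPow 𝕜 m 0 i) • uElt 𝕜 m hm n ((i : ℤ) - 1) j k := by
  apply (coords 𝕜 hm n).injective
  ext ⟨⟨i', j', k'⟩, h'⟩
  simp only [coords_triDiff, triD_apply, map_add, map_smul, Pi.add_apply, Pi.smul_apply,
    coords_uElt, smul_eq_mul, mul_ite, mul_one, mul_zero, eq_sub_iff_add_eq, ← Nat.cast_add_one,
    Nat.cast_inj]
  congr 1
  · congr 1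
    · exact ite_congr rfl (fun ⟨_, _, h⟩ => by rw [h]) fun _ => rfl
    · exact ite_congr rfl (fun ⟨_, h, h'⟩ => by rw [h, h']) fun _ => rfl
  · exact ite_congr rfl (fun ⟨h, h', h''⟩ => by rw [h, h', h'', add_comm]) fun _ => rfl

end Coordinates

theorem neg_one_pow_smul {R A M : Type*} [CommRing R] [Ring A] [Algebra R A] [AddCommGroup M]
    [Module R M] [Module A M] [IsScalarTower R A M] (e : ℕ) (x : M) :
    (-1 : R) ^ e • x = (-1 : A) ^ e • x := by
  rw [← algebraMap_smul A, map_pow, map_neg, map_one]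

section BasisMultiples

variable (𝕜 : Type*) [Field 𝕜] {m : Fin 3 → ℕ} (hm : ∀ a, 2 ≤ m a)

/-- The element `r ⊗ u_{ijk}` of `P_n`, with `u_{ijk} = 0` if an index is negative. -/
noncomputable def wordElt (n : ℕ) (r : List (Fin 3)) (i j k : ℤ) :
    (truncPresentation 𝕜 m hm).Free n :=
  (truncPresentation 𝕜 m hm).eval r • uElt 𝕜 m hm n i j k

variable {𝕜} {hm} {n : ℕ} {r : List (Fin 3)}

theorem wordElt_natCast {i j k : ℕ} (h : i + j + k = n) :
    wordElt 𝕜 hm n r i j k = (truncPresentation 𝕜 m hm).ten r (triChain 𝕜 hm h) := by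
  rw [wordElt, uElt_natCast h, ten_eq_eval_smul_single]

theorem wordElt_of_neg {i j k : ℤ} (h : i < 0 ∨ j < 0 ∨ k < 0) : wordElt 𝕜 hm n r i j k = 0 := by
  rw [wordElt, uElt_eq_zero h, smul_zero]

theorem wordElt_append_comm (r s : List (Fin 3)) (i j k : ℤ) :
    wordElt 𝕜 hm n (r ++ s) i j k = wordElt 𝕜 hm n (s ++ r) i j k := by
  rw [wordElt, eval_eq_of_perm List.perm_append_comm, wordElt]

theorem eval_sigmaWord (a : Fin 3) (l : ℕ) :
    (truncPresentation 𝕜 m hm).eval (sigmaWord m a l) = sigmaPow 𝕜 m a l :=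
  eval_replicate a _

theorem wordElt_sigmaWord_succ_append (a : Fin 3) (l : ℕ) (i j k : ℤ) :
    wordElt 𝕜 hm n (sigmaWord m a (l + 1) ++ sigmaWord m a l) i j k = 0 := by
  rw [wordElt, eval_append, eval_sigmaWord, eval_sigmaWord, sigmaPow_succ_mul hm]
  exact zero_smul (TruncPoly₃ 𝕜 m) (uElt 𝕜 m hm n i j k)

theorem triDiff_wordElt (i j k : ℕ) :
    triDiff 𝕜 hm n (wordElt 𝕜 hm (n + 1) r i j k) =
      wordElt 𝕜 hm n (r ++ sigmaWord m 2 k) i j ((k : ℤ) - 1) +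
      (-1 : 𝕜) ^ k • wordElt 𝕜 hm n (r ++ sigmaWord m 1 j) i ((j : ℤ) - 1) k +
      (-1 : 𝕜) ^ (j + k) • wordElt 𝕜 hm n (r ++ sigmaWord m 0 i) ((i : ℤ) - 1) j k := by
  simp only [wordElt, map_smul, triDiff_uElt, smul_add, eval_append, eval_sigmaWord,
    neg_one_pow_smul (A := TruncPoly₃ 𝕜 m)]
  module

theorem below_wordElt {i j k : ℤ} {w : List (Fin 3)}
    (hr : (truncPresentation 𝕜 m hm).IsNormal r)
    (h : ∀ i' j' k' : ℕ, i = i' → j = j' → k = k' →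
      WordLT (r ++ (triPath m i' j' k').flatten) w) :
    Below (wordElt 𝕜 hm n r i j k) w := by
  rw [wordElt, uElt]
  split_ifs with hu
  · have hsum : i.toNat + j.toNat + k.toNat = n := (length_triPath _ _ _).symm.trans hu.2.1
    change Below (_ • Finsupp.single (triChain 𝕜 hm hsum) 1) w
    rw [← ten_eq_eval_smul_single]
    exact below_ten hr (h _ _ _ (by lia) (by lia) (by lia))
  · rw [smul_zero]
    exact below_zero w

theorem isNormal_sigmaWord_append {a c : Fin 3} (hac : a < c) (l l' : ℕ) :
    (truncPresentation 𝕜 m hm).IsNormal (sigmaWord m a l ++ sigmaWord m c l') :=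
  isNormal_replicate_append_replicate hac (truncSigma_lt (hm a) l) (truncSigma_lt (hm c) l')

end BasisMultiples

section Reduction

variable {𝕜 : Type*} [Field 𝕜] {m : Fin 3 → ℕ} {hm : ∀ a, 2 ≤ m a} {n : ℕ}

include hm in
theorem wordLT_append_sigmaWord_append {a c : Fin 3} (hac : a < c) {l l' : ℕ}
    (p : List (Fin 3)) {v w : List (Fin 3)}
    (hlen : (sigmaWord m a l ++ v).length = (sigmaWord m c l' ++ w).length) :
    WordLT (p ++ (sigmaWord m a l ++ v)) (p ++ (sigmaWord m c l' ++ w)) := by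
  obtain ⟨e, he⟩ := Nat.exists_eq_add_one.2 (truncSigma_pos (hm a) l)
  obtain ⟨f, hf⟩ := Nat.exists_eq_add_one.2 (truncSigma_pos (hm c) l')
  simp only [sigmaWord, he, hf, List.replicate_succ, List.cons_append, List.length_cons] at hlen ⊢
  exact wordLT_append_cons hac p (Nat.succ.inj hlen)

theorem length_flatten_powPath_succ (a : Fin 3) (l : ℕ) :
    (powPath a (m a) (l + 1)).flatten.length =
      (sigmaWord m a (l + 1)).length + (powPath a (m a) l).flatten.length := by
  rw [powPath, List.flatten_cons, List.length_append, sigmaWord]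

theorem length_flatten_triPath (i j k : ℕ) :
    (triPath m i j k).flatten.length = (powPath 2 (m 2) k).flatten.length +
      (powPath 1 (m 1) j).flatten.length + (powPath 0 (m 0) i).flatten.length := by
  simp only [triPath, List.flatten_append, List.length_append]

theorem below_wordElt_left_mid {i j k l : ℕ} {b : Fin 3} (hb : 0 < b) {v : List (Fin 3)}
    (hlen : (sigmaWord m b l ++ v).length = (triPath m i j k).flatten.length) :
    Below (wordElt 𝕜 hm n (sigmaWord m 0 i ++ sigmaWord m 1 j) ((i : ℤ) - 1) ((j : ℤ) - 1) k)
      (sigmaWord m b l ++ v) := by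
  refine below_wordElt (isNormal_sigmaWord_append Fin.zero_lt_one i j) fun i' j' k' hi hj hk => ?_
  obtain rfl : i = i' + 1 := by lia
  obtain rfl : j = j' + 1 := by lia
  obtain rfl : k = k' := by lia
  rw [List.append_assoc]
  refine wordLT_append_sigmaWord_append (hm := hm) hb [] ?_
  simp only [List.length_append, length_flatten_triPath, length_flatten_powPath_succ] at hlen ⊢
  lia

theorem below_wordElt_left_right {i j k l : ℕ} {b : Fin 3} (hb : 0 < b) {v : List (Fin 3)}
    (hlen : (sigmaWord m b l ++ v).length = (triPath m i j k).flatten.length) :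
    Below (wordElt 𝕜 hm n (sigmaWord m 0 i ++ sigmaWord m 2 k) ((i : ℤ) - 1) j ((k : ℤ) - 1))
      (sigmaWord m b l ++ v) := by
  refine below_wordElt (isNormal_sigmaWord_append (by decide) i k) fun i' j' k' hi hj hk => ?_
  obtain rfl : i = i' + 1 := by lia
  obtain rfl : j = j' := by lia
  obtain rfl : k = k' + 1 := by lia
  rw [List.append_assoc]
  refine wordLT_append_sigmaWord_append (hm := hm) hb [] ?_
  simp only [List.length_append, length_flatten_triPath, length_flatten_powPath_succ] at hlen ⊢
  lia

theorem triDiff_wordElt_left (i j k : ℕ) :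
    triDiff 𝕜 hm n (wordElt 𝕜 hm (n + 1) (sigmaWord m 0 i) ((i : ℤ) - 1) j k) =
      wordElt 𝕜 hm n (sigmaWord m 0 i ++ sigmaWord m 2 k) ((i : ℤ) - 1) j ((k : ℤ) - 1) +
      (-1 : 𝕜) ^ k •
        wordElt 𝕜 hm n (sigmaWord m 0 i ++ sigmaWord m 1 j) ((i : ℤ) - 1) ((j : ℤ) - 1) k := by
  rcases i with _ | i
  · simp only [wordElt_of_neg (Or.inl (by lia : ((0 : ℕ) : ℤ) - 1 < 0)), map_zero, smul_zero,
      add_zero]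
  · rw [Nat.cast_add_one, add_sub_cancel_right, triDiff_wordElt, wordElt_sigmaWord_succ_append,
      smul_zero, add_zero]

theorem triDiff_wordElt_mid (i j k : ℕ) :
    triDiff 𝕜 hm n (wordElt 𝕜 hm (n + 1) (sigmaWord m 1 j) i ((j : ℤ) - 1) k) =
      wordElt 𝕜 hm n (sigmaWord m 1 j ++ sigmaWord m 2 k) i ((j : ℤ) - 1) ((k : ℤ) - 1) +
      (-1 : 𝕜) ^ (j - 1 + k) •
        wordElt 𝕜 hm n (sigmaWord m 0 i ++ sigmaWord m 1 j) ((i : ℤ) - 1) ((j : ℤ) - 1) k := by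
  rcases j with _ | j
  · simp only [wordElt_of_neg (Or.inr (Or.inl (by lia : ((0 : ℕ) : ℤ) - 1 < 0))), map_zero,
      smul_zero, add_zero]
  · rw [Nat.cast_add_one, add_sub_cancel_right, triDiff_wordElt, wordElt_sigmaWord_succ_append,
      smul_zero, add_zero, wordElt_append_comm _ (sigmaWord m 0 i), Nat.add_sub_cancel]

theorem reduces_boundary_smul_wordElt_add {c : 𝕜} (hc : c ≠ 0) {r f : List (Fin 3)}
    {i j k i' j' k' : ℕ} (h : i + j + k = n + 2) (h' : i' + j' + k' = n + 1)
    (hpath : triPath m i j k = f :: triPath m i' j' k')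
    (hr : (truncPresentation 𝕜 m hm).IsNormal (r ++ f))
    {x : (truncPresentation 𝕜 m hm).Free (n + 1)} {z : (truncPresentation 𝕜 m hm).Free (n + 2)}
    (hd : triDiff 𝕜 hm (n + 1) (c • wordElt 𝕜 hm (n + 2) r i j k + z) =
      c • wordElt 𝕜 hm (n + 1) (r ++ f) i' j' k' + x)
    (hx : Below x (r ++ (triPath m i j k).flatten))
    (hz : Reduces _ (triDiff 𝕜 hm (n + 1)) (triDiff 𝕜 hm (n + 1) z) z) :
    Reduces _ (triDiff 𝕜 hm (n + 1))
      (triDiff 𝕜 hm (n + 1) (c • wordElt 𝕜 hm (n + 2) r i j k + z))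
      (c • wordElt 𝕜 hm (n + 2) r i j k + z) := by
  have htop : (triChain 𝕜 hm h).top = f := by simp only [Chain.top, triChain, hpath, List.head_cons]
  have htail : (triChain 𝕜 hm h).tail = triChain 𝕜 hm h' :=
    Subtype.ext (by simp only [Chain.tail, triChain, hpath, List.tail_cons])
  rw [wordElt_natCast h] at hd ⊢
  rw [wordElt_natCast h', ← htail, ← htop] at hd
  exact reduces_boundary_smul_ten_add hc (htop ▸ hr) hd hx hz

theorem reduces_boundary_wordElt_left {i j k : ℕ} (h : i + j + k = n + 3) (hjk : 0 < j + k)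
    {c : 𝕜} (hc : c ≠ 0) :
    Reduces _ (triDiff 𝕜 hm (n + 1))
      (triDiff 𝕜 hm (n + 1) (c • wordElt 𝕜 hm (n + 2) (sigmaWord m 0 i) ((i : ℤ) - 1) j k))
      (c • wordElt 𝕜 hm (n + 2) (sigmaWord m 0 i) ((i : ℤ) - 1) j k) := by
  have hd := congrArg (c • ·) (triDiff_wordElt_left (𝕜 := 𝕜) (hm := hm) (n := n + 1) i j k)
  simp only [← LinearMap.map_smul_of_tower, smul_add] at hd
  rcases i with _ | i
  · rw [wordElt_of_neg (by lia), smul_zero, map_zero]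
    exact Reduces.zero
  rw [Nat.cast_add_one, add_sub_cancel_right] at hd ⊢
  rw [← add_zero (c • wordElt _ _ _ _ _ _ _)] at hd ⊢
  rcases k with _ | k
  · obtain ⟨j, rfl⟩ := Nat.exists_eq_add_one.2 hjk
    refine reduces_boundary_smul_wordElt_add hc (f := sigmaWord m 1 (j + 1)) (x := 0) (by lia)
      (by lia : i + j + 0 = n + 1) rfl (isNormal_sigmaWord_append Fin.zero_lt_one _ _) ?_
      (below_zero _) (by rw [map_zero]; exact Reduces.zero)
    rw [hd, wordElt_of_neg (by lia), smul_zero, zero_add, pow_zero, one_smul, add_zero,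
      Nat.cast_add_one, add_sub_cancel_right]
  · refine reduces_boundary_smul_wordElt_add hc (f := sigmaWord m 2 (k + 1)) (by lia)
      (by lia : i + j + k = n + 1) rfl (isNormal_sigmaWord_append (by decide) _ _)
      (by rw [hd, Nat.cast_add_one k, add_sub_cancel_right]) ?_
      (by rw [map_zero]; exact Reduces.zero)
    refine ((below_wordElt (isNormal_sigmaWord_append Fin.zero_lt_one _ _) ?_).smul _).smul _
    intro i' j' k' hi hj hk
    obtain rfl : i = i' := by lia
    obtain rfl : j = j' + 1 := by lia
    obtain rfl : k + 1 = k' := by lia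
    rw [List.append_assoc, triPath_succ_right i (j' + 1), List.flatten_cons]
    refine wordLT_append_sigmaWord_append (hm := hm) (by decide) _ ?_
    simp only [List.length_append, length_flatten_triPath, length_flatten_powPath_succ]
    lia

theorem reduces_boundary_wordElt_mid {i j k : ℕ} (h : i + j + k = n + 3) (hk : 0 < k)
    {c c' : 𝕜} (hc : c ≠ 0) (hc' : c' ≠ 0) :
    Reduces _ (triDiff 𝕜 hm (n + 1))
      (triDiff 𝕜 hm (n + 1) (c • wordElt 𝕜 hm (n + 2) (sigmaWord m 1 j) i ((j : ℤ) - 1) k +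
        c' • wordElt 𝕜 hm (n + 2) (sigmaWord m 0 i) ((i : ℤ) - 1) j k))
      (c • wordElt 𝕜 hm (n + 2) (sigmaWord m 1 j) i ((j : ℤ) - 1) k +
        c' • wordElt 𝕜 hm (n + 2) (sigmaWord m 0 i) ((i : ℤ) - 1) j k) := by
  have hz := reduces_boundary_wordElt_left (hm := hm) h (by lia) hc'
  rcases j with _ | j
  · rwa [wordElt_of_neg (by lia), smul_zero, zero_add]
  obtain ⟨k, rfl⟩ := Nat.exists_eq_add_one.2 hk
  have hlen : (sigmaWord m 1 (j + 1) ++ (triPath m i j (k + 1)).flatten).length =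
      (triPath m i (j + 1) (k + 1)).flatten.length := by
    simp only [List.length_append, length_flatten_triPath, length_flatten_powPath_succ]
    lia
  have hd := congrArg₂ (c • · + c' • ·)
    (triDiff_wordElt_mid (𝕜 := 𝕜) (hm := hm) (n := n + 1) i (j + 1) (k + 1))
    (triDiff_wordElt_left (𝕜 := 𝕜) (hm := hm) (n := n + 1) i (j + 1) (k + 1))
  simp only [← LinearMap.map_smul_of_tower, ← map_add] at hd
  rw [smul_add] at hd
  replace hd := hd.trans (add_assoc _ _ _)
  have hj : ((j + 1 : ℕ) : ℤ) - 1 = j := by lia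
  have hk : ((k + 1 : ℕ) : ℤ) - 1 = k := by lia
  have hWX := below_wordElt_left_mid (𝕜 := 𝕜) (hm := hm) (n := n + 1) Fin.zero_lt_one hlen
  have hWY := below_wordElt_left_right (𝕜 := 𝕜) (hm := hm) (n := n + 1) Fin.zero_lt_one hlen
  rw [hj] at hd hWX ⊢
  rw [hk] at hd hWY
  exact reduces_boundary_smul_wordElt_add hc (by lia) (by lia : i + j + k = n + 1) rfl
    (isNormal_sigmaWord_append (by decide) _ _) hd
    (((hWX.smul _).smul c).add ((hWY.add (hWX.smul _)).smul c')) hz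

end Reduction

section Differentials

variable {𝕜 : Type*} [Field 𝕜] {m : Fin 3 → ℕ} {hm : ∀ a, 2 ≤ m a} {n i j k : ℕ}

theorem triDiff_single_triChain (h : i + j + k = n + 1) :
    triDiff 𝕜 hm n (Finsupp.single (triChain 𝕜 hm h) 1) =
      wordElt 𝕜 hm n (sigmaWord m 2 k) i j ((k : ℤ) - 1) +
      (-1 : 𝕜) ^ k • wordElt 𝕜 hm n (sigmaWord m 1 j) i ((j : ℤ) - 1) k +
      (-1 : 𝕜) ^ (j + k) • wordElt 𝕜 hm n (sigmaWord m 0 i) ((i : ℤ) - 1) j k := by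
  rw [← uElt_natCast h, triDiff_uElt]
  simp only [wordElt, eval_sigmaWord, neg_one_pow_smul (A := TruncPoly₃ 𝕜 m)]
  module

theorem ten_top_tail_triChain_right (h : i + j + (k + 1) = n + 1) :
    (truncPresentation 𝕜 m hm).ten (triChain 𝕜 hm h).top (triChain 𝕜 hm h).tail =
      wordElt 𝕜 hm n (sigmaWord m 2 (k + 1)) i j k :=
  (wordElt_natCast (by lia : i + j + k = n)).symm

theorem ten_top_tail_triChain_mid (h : i + (j + 1) + 0 = n + 1) :
    (truncPresentation 𝕜 m hm).ten (triChain 𝕜 hm h).top (triChain 𝕜 hm h).tail =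
      wordElt 𝕜 hm n (sigmaWord m 1 (j + 1)) i j (0 : ℕ) :=
  (wordElt_natCast (by lia : i + j + 0 = n)).symm

theorem ten_top_tail_triChain_left (h : i + 1 + 0 + 0 = n + 1) :
    (truncPresentation 𝕜 m hm).ten (triChain 𝕜 hm h).top (triChain 𝕜 hm h).tail =
      wordElt 𝕜 hm n (sigmaWord m 0 (i + 1)) i (0 : ℕ) (0 : ℕ) :=
  (wordElt_natCast (by lia : i + 0 + 0 = n)).symm

theorem eq_of_triDiff_single_add_eq_ten (h : i + j + k = n + 1)
    {z : (truncPresentation 𝕜 m hm).Free n}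
    (hz : triDiff 𝕜 hm n (Finsupp.single (triChain 𝕜 hm h) 1) + z =
      (truncPresentation 𝕜 m hm).ten (triChain 𝕜 hm h).top (triChain 𝕜 hm h).tail) :
    (0 < k ∧ ∃ c c' : 𝕜, c ≠ 0 ∧ c' ≠ 0 ∧
      z = c • wordElt 𝕜 hm n (sigmaWord m 1 j) i ((j : ℤ) - 1) k +
        c' • wordElt 𝕜 hm n (sigmaWord m 0 i) ((i : ℤ) - 1) j k) ∨
    (0 < j + k ∧ ∃ c : 𝕜, c ≠ 0 ∧
      z = c • wordElt 𝕜 hm n (sigmaWord m 0 i) ((i : ℤ) - 1) j k) ∨ z = 0 := by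
  have hsign (e : ℕ) : -(-1 : 𝕜) ^ e ≠ 0 :=
    neg_ne_zero.2 (pow_ne_zero e (neg_ne_zero.2 one_ne_zero))
  rw [triDiff_single_triChain] at hz
  rcases k with _ | k
  · rw [wordElt_of_neg (by lia), zero_add, pow_zero, one_smul] at hz
    rcases j with _ | j
    · obtain ⟨i, rfl⟩ : ∃ i', i = i' + 1 := ⟨n, by lia⟩
      rw [ten_top_tail_triChain_left, wordElt_of_neg (by lia), zero_add, pow_zero, one_smul,
        Nat.cast_add_one, add_sub_cancel_right] at hz
      exact Or.inr (Or.inr (add_eq_left.1 hz))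
    · rw [ten_top_tail_triChain_mid, Nat.cast_add_one j, add_sub_cancel_right, add_assoc] at hz
      refine Or.inr (Or.inl ⟨by lia, _, hsign (j + 1), ?_⟩)
      rw [neg_smul]
      exact eq_neg_of_add_eq_zero_right (add_eq_left.1 hz)
  · rw [ten_top_tail_triChain_right, Nat.cast_add_one k, add_sub_cancel_right, add_assoc,
      add_assoc] at hz
    refine Or.inl ⟨by lia, _, _, hsign (k + 1), hsign (j + (k + 1)), ?_⟩
    rw [neg_smul, neg_smul, ← neg_add]
    exact eq_neg_of_add_eq_zero_right ((add_assoc _ _ _).trans (add_eq_left.1 hz))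

theorem stage_zero_s_d_smul_wordElt {a b : Fin 3} (hab : a < b) (c : 𝕜) {i j k : ℕ}
    (h : i + j + k = 1) (hb : triPath m i j k = [[b]]) :
    ((truncPresentation 𝕜 m hm).stage 0).s (((truncPresentation 𝕜 m hm).stage 0).d
      (c • wordElt 𝕜 hm 1 (sigmaWord m a 1) i j k)) =
        c • wordElt 𝕜 hm 1 (sigmaWord m a 1) i j k := by
  have hword : wordElt 𝕜 hm 1 (sigmaWord m a 1) i j k =
      (truncPresentation 𝕜 m hm).ten [a] ((truncPresentation 𝕜 m hm).letterChain b) := by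
    rw [wordElt_natCast h, sigmaWord, truncSigma_one]
    exact congrArg _ (Subtype.ext hb)
  have hnormal : (truncPresentation 𝕜 m hm).IsNormal ([a] ++ [b]) := by
    have := isNormal_sigmaWord_append (𝕜 := 𝕜) (hm := hm) hab 1 1
    rwa [sigmaWord, sigmaWord, truncSigma_one, truncSigma_one] at this
  rw [LinearMap.map_smul_of_tower, stage_zero_s_smul, hword,
    stage_zero_s_d_ten_letterChain hnormal]

theorem stage_zero_s_d_eq_of_triDiff_add_eq_ten (u : (truncPresentation 𝕜 m hm).Chain 2)
    {z : (truncPresentation 𝕜 m hm).Free 1}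
    (hz : triDiff 𝕜 hm 1 (Finsupp.single u 1) + z =
      (truncPresentation 𝕜 m hm).ten u.top u.tail) :
    ((truncPresentation 𝕜 m hm).stage 0).s (((truncPresentation 𝕜 m hm).stage 0).d z) = z := by
  have hzero : ((truncPresentation 𝕜 m hm).stage 0).s
      (((truncPresentation 𝕜 m hm).stage 0).d 0) = 0 := by
    rw [map_zero, stage_s_zero]
  have hletter : [List.replicate (truncSigma (m 2) 1) (2 : Fin 3)] = [[2]] ∧
      [List.replicate (truncSigma (m 1) 1) (1 : Fin 3)] = [[1]] := by
    simp only [truncSigma_one, List.replicate_one, and_self]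
  obtain ⟨i, j, k, h, rfl⟩ := exists_eq_triChain u
  rcases eq_of_triDiff_single_add_eq_ten h hz with
    ⟨hk, c, c', -, -, rfl⟩ | ⟨hjk, c, -, rfl⟩ | rfl
  · obtain ⟨rfl, rfl, rfl⟩ | ⟨rfl, rfl, rfl⟩ | ⟨rfl, rfl, rfl⟩ :
        i = 0 ∧ j = 0 ∧ k = 2 ∨ i = 0 ∧ j = 1 ∧ k = 1 ∨ i = 1 ∧ j = 0 ∧ k = 1 := by lia
    · rwa [wordElt_of_neg (by lia), wordElt_of_neg (by lia), smul_zero, smul_zero, add_zero]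
    · rw [wordElt_of_neg (i := ((0 : ℕ) : ℤ) - 1) (by lia), smul_zero, add_zero]
      exact stage_zero_s_d_smul_wordElt (by decide) c (i := 0) (j := 0) (k := 1) rfl hletter.1
    · simp only [wordElt_of_neg (j := ((0 : ℕ) : ℤ) - 1) (by lia), smul_zero, zero_add]
      exact stage_zero_s_d_smul_wordElt (by decide) c' (i := 0) (j := 0) (k := 1) rfl hletter.1
  · obtain rfl | ⟨rfl, rfl, rfl⟩ | ⟨rfl, rfl, rfl⟩ :
        i = 0 ∨ i = 1 ∧ j = 1 ∧ k = 0 ∨ i = 1 ∧ j = 0 ∧ k = 1 := by lia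
    · rwa [wordElt_of_neg (by lia), smul_zero]
    · exact stage_zero_s_d_smul_wordElt (by decide) c (i := 0) (j := 1) (k := 0) rfl hletter.2
    · exact stage_zero_s_d_smul_wordElt (by decide) c (i := 0) (j := 0) (k := 1) rfl hletter.1
  · exact hzero

theorem reduces_of_triDiff_add_eq_ten (u : (truncPresentation 𝕜 m hm).Chain (n + 3))
    {z : (truncPresentation 𝕜 m hm).Free (n + 2)}
    (hz : triDiff 𝕜 hm (n + 2) (Finsupp.single u 1) + z =
      (truncPresentation 𝕜 m hm).ten u.top u.tail) :
    Reduces _ (triDiff 𝕜 hm (n + 1)) (triDiff 𝕜 hm (n + 1) z) z := by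
  obtain ⟨i, j, k, h, rfl⟩ := exists_eq_triChain u
  rcases eq_of_triDiff_single_add_eq_ten h hz with
    ⟨hk, c, c', hc, hc', rfl⟩ | ⟨hjk, c, hc, rfl⟩ | rfl
  · exact reduces_boundary_wordElt_mid h hk hc hc'
  · exact reduces_boundary_wordElt_left h hjk hc
  · rw [map_zero]
    exact Reduces.zero

theorem triDiff_zero_single (u : (truncPresentation 𝕜 m hm).Chain 1) :
    triDiff 𝕜 hm 0 (Finsupp.single u 1) =
      (truncPresentation 𝕜 m hm).ten u.top (truncPresentation 𝕜 m hm).nilChain := by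
  have htail : u.tail = (truncPresentation 𝕜 m hm).nilChain :=
    Subtype.ext (List.eq_nil_of_length_eq_zero u.tail.2.1)
  rw [← htail]
  obtain ⟨i, j, k, h, rfl⟩ := exists_eq_triChain u
  have hz := add_sub_cancel (triDiff 𝕜 hm 0 (Finsupp.single (triChain 𝕜 hm h) 1))
    ((truncPresentation 𝕜 m hm).ten (triChain 𝕜 hm h).top (triChain 𝕜 hm h).tail)
  refine (sub_eq_zero.1 ?_).symm
  rcases eq_of_triDiff_single_add_eq_ten h hz with
    ⟨hk, c, c', -, -, hz⟩ | ⟨hjk, c, -, hz⟩ | hz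
  · rw [hz, wordElt_of_neg (by lia), wordElt_of_neg (by lia), smul_zero, smul_zero, add_zero]
  · rw [hz, wordElt_of_neg (by lia), smul_zero]
  · exact hz

theorem anickD_eq_triDiff (n : ℕ) : (truncPresentation 𝕜 m hm).anickD n = triDiff 𝕜 hm n :=
  stage_d_eq_of_reduces (triDiff 𝕜 hm) triDiff_triDiff triDiff_zero_single
    (fun u _ => stage_zero_s_d_eq_of_triDiff_add_eq_ten u)
    (fun _ u _ => reduces_of_triDiff_add_eq_ten u) n

end Differentials

end TruncAnick

section Periodic

variable (𝕜 : Type*) [Field 𝕜]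

theorem truncVar₁_pow (m : ℕ) : truncVar₁ 𝕜 m ^ m = 0 := by
  rw [truncVar₁, ← AdjoinRoot.mk_X, ← map_pow, AdjoinRoot.mk_self]

variable {𝕜}

theorem truncVar₁_pow_mul_mk (m q : ℕ) (f : Polynomial 𝕜) :
    truncVar₁ 𝕜 m ^ q * AdjoinRoot.mk _ f = AdjoinRoot.mk _ (Polynomial.X ^ q * f) := by
  rw [map_mul, map_pow, AdjoinRoot.mk_X, truncVar₁]

theorem exact_mulLeft_truncVar₁_pow {m p q : ℕ} (h : p + q = m) :
    Function.Exact (LinearMap.mulLeft (TruncPoly₁ 𝕜 m) (truncVar₁ 𝕜 m ^ p))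
      (LinearMap.mulLeft (TruncPoly₁ 𝕜 m) (truncVar₁ 𝕜 m ^ q)) := by
  intro b
  obtain ⟨f, rfl⟩ := AdjoinRoot.mk_surjective b
  simp only [LinearMap.mulLeft_apply, Set.mem_range]
  constructor
  · intro hb
    rw [truncVar₁_pow_mul_mk, AdjoinRoot.mk_eq_zero, ← h, add_comm, pow_add,
      mul_dvd_mul_iff_left (pow_ne_zero _ Polynomial.X_ne_zero)] at hb
    obtain ⟨g, rfl⟩ := hb
    exact ⟨AdjoinRoot.mk _ g, truncVar₁_pow_mul_mk _ _ _⟩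
  · rintro ⟨c, hc⟩
    rw [← hc, ← mul_assoc, ← pow_add, add_comm, h, truncVar₁_pow, zero_mul]

theorem truncAug₁_truncVar₁ {m : ℕ} (hm : 2 ≤ m) : truncAug₁ 𝕜 m hm (truncVar₁ 𝕜 m) = 0 :=
  AdjoinRoot.liftAlgHom_root _ _ _ _

theorem truncAug₁_periodicD {m : ℕ} (hm : 2 ≤ m) (n : ℕ) (b : TruncPoly₁ 𝕜 m) :
    truncAug₁ 𝕜 m hm (periodicD 𝕜 m n b) = 0 := by
  rw [periodicD, LinearMap.mulLeft_apply, map_mul, map_pow, truncAug₁_truncVar₁,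
    zero_pow (truncSigma_pos hm _).ne', zero_mul]

theorem exact_periodicD_zero_truncAug₁ {m : ℕ} (hm : 2 ≤ m) :
    Function.Exact (periodicD 𝕜 m 0) (truncAug₁ 𝕜 m hm) := by
  refine fun b => ⟨fun hb => ?_, ?_⟩
  · obtain ⟨f, rfl⟩ := AdjoinRoot.mk_surjective b
    obtain ⟨g, rfl⟩ : Polynomial.X ∣ f := by
      rw [Polynomial.X_dvd_iff]
      simpa [truncAug₁] using hb
    refine ⟨AdjoinRoot.mk _ g, ?_⟩
    rw [periodicD, LinearMap.mulLeft_apply, truncSigma_one, truncVar₁_pow_mul_mk, pow_one]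
  · rintro ⟨c, rfl⟩
    exact truncAug₁_periodicD hm 0 c

theorem isMinimalResolution_periodicD {m : ℕ} (hm : 2 ≤ m) :
    IsMinimalResolution (periodicD 𝕜 m) (truncAug₁ 𝕜 m hm) :=
  ⟨fun c => ⟨algebraMap 𝕜 _ c, (truncAug₁ 𝕜 m hm).commutes c⟩, exact_periodicD_zero_truncAug₁ hm,
    fun n => exact_mulLeft_truncVar₁_pow (truncSigma_succ_add hm (n + 1)), truncAug₁_periodicD hm⟩

end Periodic

namespace TruncAnick

section TensorEquiv

variable (𝕜 : Type*) [Field 𝕜] (m : Fin 3 → ℕ)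

/-- The images of the variables `w, x, y` in `A_y ⊗ A_x ⊗ A_w`. -/
noncomputable def tensorVar : Fin 3 → TruncTensor 𝕜 m :=
  ![(1 ⊗ₜ 1) ⊗ₜ truncVar₁ 𝕜 (m 0), (1 ⊗ₜ truncVar₁ 𝕜 (m 1)) ⊗ₜ 1,
    (truncVar₁ 𝕜 (m 2) ⊗ₜ 1) ⊗ₜ 1]

theorem tensorVar_pow (a : Fin 3) : tensorVar 𝕜 m a ^ m a = 0 := by
  fin_cases a <;>
    simp [tensorVar, Algebra.TensorProduct.tmul_pow, truncVar₁_pow, TensorProduct.tmul_zero,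
      TensorProduct.zero_tmul]

/-- The homomorphism `A → A_y ⊗ A_x ⊗ A_w` that maps each variable to the variable of the
corresponding factor. -/
noncomputable def toTensor : TruncPoly₃ 𝕜 m →ₐ[𝕜] TruncTensor 𝕜 m :=
  Ideal.Quotient.liftₐ _ (MvPolynomial.aeval (tensorVar 𝕜 m)) <| by
    intro p hp
    rw [← RingHom.mem_ker]
    refine Ideal.span_le.2 ?_ hp
    rintro _ ⟨a, rfl⟩
    simp [RingHom.mem_ker, tensorVar_pow]

theorem toTensor_truncVar₃ (a : Fin 3) : toTensor 𝕜 m (truncVar₃ 𝕜 m a) = tensorVar 𝕜 m a :=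
  MvPolynomial.aeval_X (tensorVar 𝕜 m) a

/-- The inclusion into `A` of the truncated polynomial ring in the variable with index `a`. -/
noncomputable def factorHom (a : Fin 3) : TruncPoly₁ 𝕜 (m a) →ₐ[𝕜] TruncPoly₃ 𝕜 m :=
  AdjoinRoot.liftAlgHom _ (Algebra.ofId 𝕜 _) (truncVar₃ 𝕜 m a) (by simp [truncVar₃_pow])

theorem factorHom_truncVar₁ (a : Fin 3) :
    factorHom 𝕜 m a (truncVar₁ 𝕜 (m a)) = truncVar₃ 𝕜 m a :=
  AdjoinRoot.liftAlgHom_root _ _ _ _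

/-- The homomorphism `A_y ⊗ A_x ⊗ A_w → A` that multiplies the images of the factors. -/
noncomputable def ofTensor : TruncTensor 𝕜 m →ₐ[𝕜] TruncPoly₃ 𝕜 m :=
  Algebra.TensorProduct.productMap
    (Algebra.TensorProduct.productMap (factorHom 𝕜 m 2) (factorHom 𝕜 m 1)) (factorHom 𝕜 m 0)

theorem ofTensor_tensorVar (a : Fin 3) : ofTensor 𝕜 m (tensorVar 𝕜 m a) = truncVar₃ 𝕜 m a := by
  fin_cases a <;> simp [ofTensor, tensorVar, factorHom_truncVar₁]

variable {𝕜 m} in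
theorem truncPoly₃_algHom_ext {B : Type*} [Semiring B] [Algebra 𝕜 B]
    {f g : TruncPoly₃ 𝕜 m →ₐ[𝕜] B} (h : ∀ a, f (truncVar₃ 𝕜 m a) = g (truncVar₃ 𝕜 m a)) :
    f = g :=
  Ideal.Quotient.algHom_ext _ (MvPolynomial.algHom_ext h)

variable {𝕜 m} in
theorem truncTensor_algHom_ext {B : Type*} [Semiring B] [Algebra 𝕜 B]
    {f g : TruncTensor 𝕜 m →ₐ[𝕜] B} (h : ∀ a, f (tensorVar 𝕜 m a) = g (tensorVar 𝕜 m a)) :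
    f = g :=
  Algebra.TensorProduct.ext
    (Algebra.TensorProduct.ext (AdjoinRoot.algHom_ext (h 2)) (AdjoinRoot.algHom_ext (h 1)))
    (AdjoinRoot.algHom_ext (h 0))

/-- The isomorphism `A ≅ A_y ⊗ A_x ⊗ A_w`. -/
noncomputable def tensorEquiv : TruncPoly₃ 𝕜 m ≃ₐ[𝕜] TruncTensor 𝕜 m :=
  AlgEquiv.ofAlgHom (toTensor 𝕜 m) (ofTensor 𝕜 m)
    (truncTensor_algHom_ext fun a => by
      rw [AlgHom.comp_apply, ofTensor_tensorVar, toTensor_truncVar₃, AlgHom.id_apply])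
    (truncPoly₃_algHom_ext fun a => by
      rw [AlgHom.comp_apply, toTensor_truncVar₃, ofTensor_tensorVar, AlgHom.id_apply])

theorem tensorEquiv_truncVar₃ (a : Fin 3) :
    tensorEquiv 𝕜 m (truncVar₃ 𝕜 m a) = tensorVar 𝕜 m a := toTensor_truncVar₃ 𝕜 m a

theorem tensorEquiv_sigmaPow_right (l : ℕ) :
    tensorEquiv 𝕜 m (sigmaPow 𝕜 m 2 l) =
      ((truncVar₁ 𝕜 (m 2) ^ truncSigma (m 2) l) ⊗ₜ 1) ⊗ₜ 1 := by
  simp [sigmaPow, tensorEquiv_truncVar₃, tensorVar, Algebra.TensorProduct.tmul_pow]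

theorem tensorEquiv_sigmaPow_mid (l : ℕ) :
    tensorEquiv 𝕜 m (sigmaPow 𝕜 m 1 l) =
      (1 ⊗ₜ (truncVar₁ 𝕜 (m 1) ^ truncSigma (m 1) l)) ⊗ₜ 1 := by
  simp [sigmaPow, tensorEquiv_truncVar₃, tensorVar, Algebra.TensorProduct.tmul_pow]

theorem tensorEquiv_sigmaPow_left (l : ℕ) :
    tensorEquiv 𝕜 m (sigmaPow 𝕜 m 0 l) =
      (1 ⊗ₜ 1) ⊗ₜ (truncVar₁ 𝕜 (m 0) ^ truncSigma (m 0) l) := by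
  simp [sigmaPow, tensorEquiv_truncVar₃, tensorVar, Algebra.TensorProduct.tmul_pow]

theorem tensorEquiv_sigmaPow_succ_mul (hm : ∀ a, 2 ≤ m a) (a : Fin 3) (l : ℕ) :
    tensorEquiv 𝕜 m (sigmaPow 𝕜 m a (l + 1)) * tensorEquiv 𝕜 m (sigmaPow 𝕜 m a l) = 0 := by
  rw [← map_mul, sigmaPow_succ_mul hm, map_zero]

end TensorEquiv

section TensorProductComplex

variable {𝕜 : Type*} [Field 𝕜] {m : Fin 3 → ℕ}

theorem KD_eq_triD (n : ℕ) (x : KMod 𝕜 m (n + 1)) :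
    KD 𝕜 m n x = triD (fun l => tensorEquiv 𝕜 m (sigmaPow 𝕜 m 2 l))
      (fun l => tensorEquiv 𝕜 m (sigmaPow 𝕜 m 1 l))
      (fun l => tensorEquiv 𝕜 m (sigmaPow 𝕜 m 0 l)) n x := by
  have hsign (e : ℕ) (z : TruncTensor 𝕜 m) : (-1) ^ e * z = (-1 : 𝕜) ^ e • z :=
    (neg_one_pow_smul (A := TruncTensor 𝕜 m) e z).symm
  ext ⟨⟨i, j, k⟩, h⟩
  simp only [triD_apply, hsign, tensorEquiv_sigmaPow_right, tensorEquiv_sigmaPow_mid,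
    tensorEquiv_sigmaPow_left, ← LinearMap.mulLeft_apply (R := 𝕜) (A := TruncTensor 𝕜 m),
    LinearMap.mulLeft_tmul, LinearMap.mulLeft_one]
  rfl

theorem KD_KD (hm : ∀ a, 2 ≤ m a) (n : ℕ) (x : KMod 𝕜 m (n + 2)) :
    KD 𝕜 m n (KD 𝕜 m (n + 1) x) = 0 := by
  rw [KD_eq_triD, KD_eq_triD, triD_triD (tensorEquiv_sigmaPow_succ_mul 𝕜 m hm 2)
    (tensorEquiv_sigmaPow_succ_mul 𝕜 m hm 1) (tensorEquiv_sigmaPow_succ_mul 𝕜 m hm 0)]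

theorem aug_truncVar₃ (hm : ∀ a, 2 ≤ m a) (a : Fin 3) :
    (truncPresentation 𝕜 m hm).aug (truncVar₃ 𝕜 m a) = 0 :=
  (truncPresentation 𝕜 m hm).aug_gen a

theorem aug_sigmaPow (hm : ∀ a, 2 ≤ m a) (a : Fin 3) (l : ℕ) :
    (truncPresentation 𝕜 m hm).aug (sigmaPow 𝕜 m a l) = 0 := by
  rw [sigmaPow, map_pow, aug_truncVar₃, zero_pow (truncSigma_pos (hm a) l).ne']

theorem KAug_apply (hm : ∀ a, 2 ≤ m a) (x : KMod 𝕜 m 0) :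
    KAug 𝕜 m hm x =
      (truncPresentation 𝕜 m hm).aug ((tensorEquiv 𝕜 m).symm (x ⟨(0, 0, 0), rfl⟩)) := by
  have hprod : LinearMap.mul' 𝕜 𝕜 ∘ₗ TensorProduct.map (LinearMap.mul' 𝕜 𝕜 ∘ₗ
      TensorProduct.map (truncAug₁ 𝕜 (m 2) (hm 2)).toLinearMap
        (truncAug₁ 𝕜 (m 1) (hm 1)).toLinearMap) (truncAug₁ 𝕜 (m 0) (hm 0)).toLinearMap =
      (Algebra.TensorProduct.productMap (Algebra.TensorProduct.productMap
        (truncAug₁ 𝕜 (m 2) (hm 2)) (truncAug₁ 𝕜 (m 1) (hm 1)))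
          (truncAug₁ 𝕜 (m 0) (hm 0))).toLinearMap :=
    TensorProduct.ext_threefold fun _ _ _ => rfl
  have haug : Algebra.TensorProduct.productMap (Algebra.TensorProduct.productMap
      (truncAug₁ 𝕜 (m 2) (hm 2)) (truncAug₁ 𝕜 (m 1) (hm 1))) (truncAug₁ 𝕜 (m 0) (hm 0)) =
        (truncPresentation 𝕜 m hm).aug.comp (tensorEquiv 𝕜 m).symm.toAlgHom := by
    refine truncTensor_algHom_ext fun a => ?_
    rw [AlgHom.comp_apply, ← tensorEquiv_truncVar₃]
    trans 0
    · fin_cases a <;> simp [tensorEquiv_truncVar₃, tensorVar, truncAug₁_truncVar₁]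
    · refine Eq.trans (aug_truncVar₃ hm a).symm (congrArg _ ?_)
      exact ((tensorEquiv 𝕜 m).symm_apply_apply _).symm
  exact (LinearMap.congr_fun hprod _).trans (DFunLike.congr_fun haug _)

theorem KAug_KD (hm : ∀ a, 2 ≤ m a) (x : KMod 𝕜 m 1) : KAug 𝕜 m hm (KD 𝕜 m 0 x) = 0 := by
  rw [KAug_apply, KD_eq_triD, triD_apply]
  simp only [map_add, map_mul, AlgEquiv.symm_apply_apply, aug_sigmaPow, zero_mul, mul_zero,
    add_zero]

end TensorProductComplex

section Isomorphism

variable {𝕜 : Type*} [Field 𝕜] {m : Fin 3 → ℕ}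

theorem map_triD {R R' : Type*} [CommRing R] [CommRing R'] (f : R →+* R') (y x w : ℕ → R) (n : ℕ)
    (g : TriDeg (n + 1) → R) (t : TriDeg n) :
    f (triD y x w n g t) =
      triD (fun l => f (y l)) (fun l => f (x l)) (fun l => f (w l)) n (fun s => f (g s)) t := by
  obtain ⟨⟨i, j, k⟩, h⟩ := t
  simp only [triD_apply, map_add, map_mul, map_pow, map_neg, map_one]

variable (𝕜) in
/-- The isomorphism `P_n ≅ K_n` that is the isomorphism `A ≅ A_y ⊗ A_x ⊗ A_w` on each coordinate
with respect to the basis of the `1 ⊗ u_{ijk}`. -/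
noncomputable def anickEquiv (hm : ∀ a, 2 ≤ m a) (n : ℕ) :
    (truncPresentation 𝕜 m hm).Free n ≃+ KMod 𝕜 m n :=
  (coords 𝕜 hm n).toAddEquiv.trans
    (AddEquiv.piCongrRight fun _ => (tensorEquiv 𝕜 m).toRingEquiv.toAddEquiv)

theorem anickEquiv_apply (hm : ∀ a, 2 ≤ m a) (n : ℕ) (x : (truncPresentation 𝕜 m hm).Free n)
    (t : TriDeg n) : anickEquiv 𝕜 hm n x t = tensorEquiv 𝕜 m (coords 𝕜 hm n x t) := rfl

theorem anickEquiv_smul (hm : ∀ a, 2 ≤ m a) (n : ℕ) (a : TruncPoly₃ 𝕜 m)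
    (x : (truncPresentation 𝕜 m hm).Free n) :
    anickEquiv 𝕜 hm n (a • x) = tensorEquiv 𝕜 m a • anickEquiv 𝕜 hm n x := by
  ext t
  rw [anickEquiv_apply, map_smul, Pi.smul_apply, Pi.smul_apply, anickEquiv_apply, smul_eq_mul,
    smul_eq_mul, map_mul]

theorem anickEquiv_anickD (hm : ∀ a, 2 ≤ m a) (n : ℕ)
    (x : (truncPresentation 𝕜 m hm).Free (n + 1)) :
    anickEquiv 𝕜 hm n ((truncPresentation 𝕜 m hm).anickD n x) =
      KD 𝕜 m n (anickEquiv 𝕜 hm (n + 1) x) := by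
  ext t
  rw [anickEquiv_apply, anickD_eq_triDiff, coords_triDiff, KD_eq_triD]
  exact map_triD (tensorEquiv 𝕜 m).toRingEquiv.toRingHom _ _ _ n _ t

theorem KAug_anickEquiv (hm : ∀ a, 2 ≤ m a) (x : (truncPresentation 𝕜 m hm).Free 0) :
    KAug 𝕜 m hm (anickEquiv 𝕜 hm 0 x) = (truncPresentation 𝕜 m hm).anickAug x := by
  rw [KAug_apply, anickEquiv_apply, AlgEquiv.symm_apply_apply, coords_apply]
  rfl

end Isomorphism

end TruncAnick

theorem mainTheorem5 {𝕜 : Type*} [Field 𝕜] (m : Fin 3 → ℕ) (hm : ∀ a, 2 ≤ m a) :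
    -- the elements of `C_n` are the paths `u_{ijk}` with `i + j + k = n`, each exactly once
    (∀ (n : ℕ) (p : List (List (Fin 3))), (truncPresentation 𝕜 m hm).IsChain n p ↔
      ∃! t : TriDeg n, p = triPath m t.1.1 t.1.2.1 t.1.2.2) ∧
    -- the differentials of the Anick resolution
    (∀ n i j k : ℕ, i + j + k = n + 1 →
      (truncPresentation 𝕜 m hm).anickD n (uElt 𝕜 m hm (n + 1) i j k) =
        truncVar₃ 𝕜 m 2 ^ truncSigma (m 2) k • uElt 𝕜 m hm n i j ((k : ℤ) - 1) +
        ((-1) ^ k * truncVar₃ 𝕜 m 1 ^ truncSigma (m 1) j) • uElt 𝕜 m hm n i ((j : ℤ) - 1) k +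
        ((-1) ^ (j + k) * truncVar₃ 𝕜 m 0 ^ truncSigma (m 0) i) •
          uElt 𝕜 m hm n ((i : ℤ) - 1) j k) ∧
    -- the Anick resolution is an augmented complex
    (∀ n x, (truncPresentation 𝕜 m hm).anickD n ((truncPresentation 𝕜 m hm).anickD (n + 1) x) = 0) ∧
    (∀ x, (truncPresentation 𝕜 m hm).anickAug ((truncPresentation 𝕜 m hm).anickD 0 x) = 0) ∧
    -- the periodic complexes of the three factors are minimal resolutions
    (∀ a, IsMinimalResolution (periodicD 𝕜 (m a)) (truncAug₁ 𝕜 (m a) (hm a))) ∧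
    -- their tensor product is an augmented complex
    (∀ n x, KD 𝕜 m n (KD 𝕜 m (n + 1) x) = 0) ∧ (∀ x, KAug 𝕜 m hm (KD 𝕜 m 0 x) = 0) ∧
    -- `A ≅ A_y ⊗ A_x ⊗ A_w`, and along this isomorphism the Anick resolution is isomorphic to the
    -- tensor product, by a chain map that lifts the identity of `𝕜`
    ∃ θ : TruncPoly₃ 𝕜 m ≃ₐ[𝕜] TruncTensor 𝕜 m,
      θ (truncVar₃ 𝕜 m 0) = (1 ⊗ₜ 1) ⊗ₜ truncVar₁ 𝕜 (m 0) ∧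
      θ (truncVar₃ 𝕜 m 1) = (1 ⊗ₜ truncVar₁ 𝕜 (m 1)) ⊗ₜ 1 ∧
      θ (truncVar₃ 𝕜 m 2) = (truncVar₁ 𝕜 (m 2) ⊗ₜ 1) ⊗ₜ 1 ∧
      ∃ ψ : ∀ n, (truncPresentation 𝕜 m hm).Free n ≃+ KMod 𝕜 m n,
        (∀ n (a : TruncPoly₃ 𝕜 m) x, ψ n (a • x) = θ a • ψ n x) ∧
        (∀ n x, ψ n ((truncPresentation 𝕜 m hm).anickD n x) = KD 𝕜 m n (ψ (n + 1) x)) ∧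
        (∀ x, KAug 𝕜 m hm (ψ 0 x) = (truncPresentation 𝕜 m hm).anickAug x) := by
  open TruncAnick in
  refine ⟨isChain_iff_existsUnique, fun n i j k _ => ?_, fun n x => ?_, fun x => ?_,
    fun a => isMinimalResolution_periodicD (hm a), KD_KD hm, KAug_KD hm, tensorEquiv 𝕜 m,
    tensorEquiv_truncVar₃ 𝕜 m 0, tensorEquiv_truncVar₃ 𝕜 m 1, tensorEquiv_truncVar₃ 𝕜 m 2,
    anickEquiv 𝕜 hm, anickEquiv_smul hm, anickEquiv_anickD hm, KAug_anickEquiv hm⟩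
  · rw [anickD_eq_triDiff]
    exact triDiff_uElt
  · rw [anickD_eq_triDiff, anickD_eq_triDiff, triDiff_triDiff]
  · rw [← KAug_anickEquiv, anickEquiv_anickD, KAug_KD]
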